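/- Let $(\Omega,\mu)$ be a probability space with $L_\infty(\Omega,\mu)\neq\mathbb C1$, i.e. there is a measurable set $X\subset\Omega$ with $0<\mu(X)<1$. Let $(T_t)_{t\ge 0}$, $T_t=e^{-tL}$, be an ergodic symmetric Markov semigroup on the complex space $L_\infty(\Omega,\mu)$: a weak-$*$ continuous semigroup of positive unital linear maps with $\int \bar f\,T_t g\,d\mu=\int \overline{T_tf}\,g\,d\mu$, whose only fixed points are the constants. Let $L$ be its generator, $Lf=w^*\text{-}\lim_{t\to0^+}\frac1t(f-T_tf)$ on the domain where this limit exists in $L_\infty$. Let $T_t$ and $L$ act entrywise on $\mathbb M_2$-valued functions. Write $\mathcal E(f,f)=\lim_{t\to 0^+}\frac1t\int\mathrm{tr}\big(f^*(f-T_tf)\big)d\mu\in[0,\infty]$ for the Dirichlet form on $L_\infty(\Omega,\mathbb M_2)$ and $\mathcal A_{\mathcal E}=\{f\in L_\infty(\Omega,\mathbb M_2):\mathcal E(f,f)<\infty\}$. Write $\mathrm{dom}(L)$ for the set of $f\in L_\infty(\Omega,\mathbb M_2)$ whose entries lie in the domain of $L$. Put $E_\mu(f)=\int f\,d\mu\in\mathbb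 M_2$, $\hat f=f-E_\mu(f)$, $|f|^2=f^*f$, $\|f\|_2^2=\int\mathrm{tr}(f^*f)\,d\mu$, and for bounded $g\ge0$ $$D(g\|E_\mu(g))=\int\mathrm{tr}\big(g\ln g-E_\mu(g)\ln E_\mu(g)\big)d\mu .$$ For $2\le p<\infty$ let $$\|f\|_{L_2(\mathbb M_2,L_p(\Omega))}=\inf\Big\{\|x^{-1}fy^{-1}\|_{L_p(\Omega,\mathbb M_2)} : x,y\in\mathbb M_2 \text{ positive invertible},\ \|x\|_{2r}=\|y\|_{2r}=1\Big\},\qquad \tfrac1r=\tfrac12-\tfrac1p,$$ be the norm of Pisier's vector-valued space, where $\|x\|_{2r}$ is the Schatten norm for the unnormalized trace, $\|f\|_{L_p(\Omega,\mathbb M_2)}=(\int\mathrm{tr}|f|^p\,d\mu)^{1/p}$, and $2r=\infty$ if $p=2$. Then $\|f\|_{L_2(\mathbb M_2,L_2(\Omega))}=\|f\|_2$. Let $\alpha_R$, $\alpha_2$, $\alpha_h$ be the largest real constants (with $\alpha_h\geq 0$) such that the following hold for all $f\in\mathcal A_{\mathcal E}$: $$\alpha_R\,D(|f|^2\|E_\mu(|f|^2))\le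 D(|\hat f|^2\|E_\mu(|\hat f|^2))+\|\hat f\|_2^2,\tag{Rothaus}$$ $$\alpha_2\,D(|f|^2\|E_\mu(|f|^2))\le 2\,\mathcal E(f,f),\tag{LSI}$$ $$\|T_tf\|_{L_2(\mathbb M_2,L_{p(t)}(\Omega))}\le\|f\|_{L_2(\mathbb M_2,L_2(\Omega))}\ \text{ for all } t\ge0,\quad p(t)=1+e^{2\alpha_ht}.\tag{HC}$$ Then these largest constants exist and $\alpha_R=\alpha_2=\alpha_h=0$. The same is true if the inequalities are only required for all $f\in \mathrm{dom}(L)$, where in (LSI) the right-hand side is replaced by $\int\mathrm{tr}(f^*Lf)\,d\mu$. -/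

import Mathlib

open MeasureTheory Filter Topology
open scoped ENNReal NNReal ComplexOrder Matrix

noncomputable section

namespace MatrixLSI

variable {Ω : Type*} [MeasurableSpace Ω]

/-- A symmetric (classical) Markov semigroup on the complex space `L_∞(Ω, μ)`: a weak-* continuous
semigroup of positive unital linear maps which are symmetric for `μ`.
(On a commutative algebra positive maps are completely positive, and the symmetry makes each
`T t` the dual of a map on `L_1`, so normality is automatic.) -/
structure SymmetricMarkovSemigroup (μ : Measure Ω) [IsProbabilityMeasure μ] where
  /-- the map at time `t` -/
  T : ℝ≥0 → Lp ℂ ∞ μ →ₗ[ℂ] Lp ℂ ∞ μ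
  map_zero : T 0 = LinearMap.id
  map_add : ∀ s t, T (s + t) = T s ∘ₗ T t
  unital : ∀ t, T t (Lp.const ∞ μ 1) = Lp.const ∞ μ 1
  positive : ∀ t (f : Lp ℂ ∞ μ), (∀ᵐ ω ∂μ, 0 ≤ f ω) → ∀ᵐ ω ∂μ, 0 ≤ T t f ω
  symmetric : ∀ t (f g : Lp ℂ ∞ μ), ∫ ω, star (f ω) * T t g ω ∂μ = ∫ ω, star (T t f ω) * g ω ∂μ
  continuous_weakStar : ∀ (f : Lp ℂ ∞ μ) (g : Lp ℂ 1 μ), Continuous fun t => ∫ ω, g ω * T t f ω ∂μ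

/-- The space `L_∞(Ω, M_2)`, as `M_2(L_∞(Ω))`. -/
abbrev MatLinf (μ : Measure Ω) : Type _ := Matrix (Fin 2) (Fin 2) (Lp ℂ ∞ μ)

/-- The matrix-valued function given by an element of `L_∞(Ω, M_2)`. -/
def MatLinf.toFun {μ : Measure Ω} (f : MatLinf μ) (ω : Ω) : Matrix (Fin 2) (Fin 2) ℂ :=
  Matrix.of fun i j => f i j ω

/-- The squared modulus `|F|² = F* F`, pointwise. -/
def sqAbs (F : Ω → Matrix (Fin 2) (Fin 2) ℂ) (ω : Ω) : Matrix (Fin 2) (Fin 2) ℂ := (F ω)ᴴ * F ω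

/-- The matrix-valued mean `E_μ(F) = ∫ F dμ`, taken entrywise. -/
def matMean (μ : Measure Ω) (F : Ω → Matrix (Fin 2) (Fin 2) ℂ) : Matrix (Fin 2) (Fin 2) ℂ :=
  Matrix.of fun i j => ∫ ω, F ω i j ∂μ

/-- `tr (A ln A)` for a positive semidefinite matrix `A`, with `0 ln 0 = 0`. -/
def trLog (A : Matrix (Fin 2) (Fin 2) ℂ) : ℝ := (A * cfc Real.log A).trace.re

/-- `μ ∘ tr (G ln G - E_μ(G) ln E_μ(G))`, which is the relative entropy `D(G ‖ E_μ(G))`,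
for a bounded function `G` with positive semidefinite values. -/
def matEnt (μ : Measure Ω) (G : Ω → Matrix (Fin 2) (Fin 2) ℂ) : ℝ :=
  ∫ ω, trLog (G ω) ∂μ - trLog (matMean μ G)

/-- The mean zero part of `F`. -/
def centered (μ : Measure Ω) (F : Ω → Matrix (Fin 2) (Fin 2) ℂ) (ω : Ω) :
    Matrix (Fin 2) (Fin 2) ℂ := F ω - matMean μ F

/-- `‖F‖_2² = μ ∘ tr (F* F)`. -/
def normSqL2 (μ : Measure Ω) (F : Ω → Matrix (Fin 2) (Fin 2) ℂ) : ℝ :=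
  ∫ ω, ((F ω)ᴴ * F ω).trace.re ∂μ

/-- The Schatten `p`-norm on `M_2` for the unnormalized trace:
the `ℓ_p` norm of the singular values. -/
def schattenNorm (p : ℝ≥0∞) (A : Matrix (Fin 2) (Fin 2) ℂ) : ℝ :=
  ‖WithLp.toLp p fun i : Fin 2 =>
    √((Matrix.isHermitian_conjTranspose_mul_self A).eigenvalues i)‖

/-- The norm of `L_p(Ω, M_2) = L_p(M_2, L_p(Ω))`, that is `(∫ tr |F|^p dμ)^{1/p}`. -/
def matLpNorm (μ : Measure Ω) (p : ℝ≥0∞) (F : Ω → Matrix (Fin 2) (Fin 2) ℂ) : ℝ≥0∞ :=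
  eLpNorm (fun ω => schattenNorm p (F ω)) p μ

/-- For `2 ≤ p < ∞`, the exponent `2r ∈ (2, ∞]` with `1/r = 1/2 - 1/p` (so `2r = ∞` for `p = 2`). -/
def pisierExponent (p : ℝ) : ℝ≥0∞ := (ENNReal.ofReal ((1 / 2 - 1 / p) / 2))⁻¹

/-- The norm of Pisier's space `L_2(M_2, L_p(Ω))` for `2 ≤ p < ∞`:
the infimum of `‖x⁻¹ F y⁻¹‖_{L_p(Ω, M_2)}` over positive invertible `x, y ∈ M_2` of unit
`2r`-norm, where `1/r = 1/2 - 1/p`. -/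
def pisierNorm (μ : Measure Ω) (p : ℝ) (F : Ω → Matrix (Fin 2) (Fin 2) ℂ) : ℝ≥0∞ :=
  ⨅ (x : Matrix (Fin 2) (Fin 2) ℂ) (y : Matrix (Fin 2) (Fin 2) ℂ)
    (_ : x.PosDef ∧ schattenNorm (pisierExponent p) x = 1)
    (_ : y.PosDef ∧ schattenNorm (pisierExponent p) y = 1),
    matLpNorm μ (ENNReal.ofReal p) fun ω => x⁻¹ * F ω * y⁻¹

namespace SymmetricMarkovSemigroup

variable {μ : Measure Ω} [IsProbabilityMeasure μ] (S : SymmetricMarkovSemigroup μ)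

/-- Ergodicity: the fixed points of the semigroup are the constants. -/
def IsErgodic : Prop :=
  ∀ f : Lp ℂ ∞ μ, (∀ t, S.T t f = f) → ∃ c : ℂ, f = Lp.const ∞ μ c

/-- The amplification `T_t ⊗ id` on `L_∞(Ω, M_2)`, acting entrywise. -/
def amp (t : ℝ≥0) (f : MatLinf μ) : MatLinf μ := f.map (S.T t)

/-- `g = L f`, where `L` is the generator: `(f - T_t f)/t → g` weak-* in `L_∞` as `t → 0+`. -/
def IsGenerator (f g : Lp ℂ ∞ μ) : Prop :=
  ∀ h : Lp ℂ 1 μ, Tendsto (fun t : ℝ≥0 => ((t : ℝ) : ℂ)⁻¹ * ∫ ω, h ω * (f ω - S.T t f ω) ∂μ)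
    (𝓝[>] 0) (𝓝 (∫ ω, h ω * g ω ∂μ))

/-- `g = (L ⊗ id) f` for matrix-valued functions. -/
def IsMatGenerator (f g : MatLinf μ) : Prop := ∀ i j, S.IsGenerator (f i j) (g i j)

/-- The domain of `L ⊗ id` in `L_∞(Ω, M_2)`. -/
def matDom : Set (MatLinf μ) := {f | ∃ g, S.IsMatGenerator f g}

/-- The Dirichlet form `ℰ(f, f) ∈ [0, ∞]` of `L ⊗ id`: the (monotone) limit, as `t → 0+`, of
`μ ∘ tr (f* (f - T_t f)) / t`. -/
def energy (f : MatLinf μ) : ℝ≥0∞ :=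
  ⨆ (t : ℝ≥0) (_ : 0 < t), ENNReal.ofReal
    ((t : ℝ)⁻¹ * (∫ ω, ((f.toFun ω)ᴴ * (f.toFun ω - (S.amp t f).toFun ω)).trace ∂μ).re)

/-- The Dirichlet algebra `dom(ℰ) ∩ L_∞(Ω, M_2)`. -/
def dirichletAlgebra : Set (MatLinf μ) := {f | S.energy f < ∞}

/-- The matrix-valued Rothaus inequality with constant `α`, on a class `C` of functions. -/
def Rothaus (_S : SymmetricMarkovSemigroup μ) (C : Set (MatLinf μ)) (α : ℝ) : Prop :=
  ∀ f ∈ C, α * matEnt μ (sqAbs f.toFun) ≤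
    matEnt μ (sqAbs (centered μ f.toFun)) + normSqL2 μ (centered μ f.toFun)

/-- The matrix-valued log-Sobolev inequality, for `f` in the Dirichlet algebra and with
the Dirichlet form on the right-hand side. -/
def LogSobolevForm (α : ℝ) : Prop :=
  ∀ f ∈ S.dirichletAlgebra, α * matEnt μ (sqAbs f.toFun) ≤ 2 * (S.energy f).toReal

/-- The matrix-valued log-Sobolev inequality, for `f` in the domain of the generator and with
`μ ∘ tr (f* (L ⊗ id) f)` on the right-hand side. -/
def LogSobolevGen (α : ℝ) : Prop :=
  ∀ f g : MatLinf μ, S.IsMatGenerator f g →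
    α * matEnt μ (sqAbs f.toFun) ≤ (∫ ω, ((f.toFun ω)ᴴ * g.toFun ω).trace ∂μ).re

/-- Hypercontractivity with constant `α ≥ 0`, on a class `C` of functions:
`‖T_t f‖_{L_2(M_2, L_{p(t)}(Ω))} ≤ ‖f‖_{L_2(M_2, L_2(Ω))}` for `p(t) = 1 + e^{2αt}`, `t ≥ 0`. -/
def Hypercontractive (C : Set (MatLinf μ)) (α : ℝ) : Prop :=
  0 ≤ α ∧ ∀ f ∈ C, ∀ t : ℝ≥0,
    pisierNorm μ (1 + Real.exp (2 * α * t)) (S.amp t f).toFun ≤ matLpNorm μ 2 f.toFun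

end SymmetricMarkovSemigroup

end MatrixLSI

end

/-!
The test functions are `f = e₁₁ + v e₁₂` with `v` scalar, of mean zero and small, so that
`E_μ(|f|²) = diag(1, m)` with `m = ‖v‖₂²`. The values of `f` have rank one, hence
`D(|f|² ‖ E_μ(|f|²)) ≥ -m log m`, whereas the right-hand sides of the Rothaus and log-Sobolev
inequalities are quadratic in `v`: no positive constant survives `v → 0`.

For hypercontractivity, rank-one values make every `L_p`-norm with `p ≥ 2` of `x⁻¹ f y⁻¹` at least
its `L_2`-norm, whose square is at least `a⁻¹ + m b⁻¹` when `|y|²` has diagonal `(a, b)`. The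
normalization of `y` forces `a ^ R + b ^ R ≤ 1` for some `R ≥ 1`, so either `b ≤ K⁻¹`, and the
excess over `1` is at least `K m`, or `a` stays away from `1`. Since `K` is arbitrary, this beats
`‖f‖₂² = 1 + m` for small `m`.

A nonzero `v` of mean zero in the domain of the generator is `∫_0^1 T_s f ds` for a nonzero bounded
`f` of mean zero.
-/

noncomputable section

namespace MatrixLSI

section LInfty

variable {Ω : Type*} [MeasurableSpace Ω] {μ : Measure Ω}

theorem ae_norm_le_norm (f : Lp ℂ ∞ μ) : ∀ᵐ ω ∂μ, ‖f ω‖ ≤ ‖f‖ := by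
  rw [Lp.norm_def, toReal_eLpNorm (Lp.aestronglyMeasurable f)]
  exact ae_le_lpNorm_exponent_top (Lp.memLp f)

theorem norm_le_of_ae_le {f : Lp ℂ ∞ μ} {C : ℝ} (hC : 0 ≤ C) (h : ∀ᵐ ω ∂μ, ‖f ω‖ ≤ C) :
    ‖f‖ ≤ C := by
  rw [Lp.norm_def]
  refine ENNReal.toReal_le_of_le_ofReal hC ?_
  simpa using eLpNorm_le_of_ae_bound (p := ∞) h

/-- The pairing `∫ h u dμ` of `h ∈ L_1` with `u ∈ L_∞`; it defines the weak-* topology. -/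
abbrev dualPairing : Lp ℂ 1 μ →L[ℂ] Lp ℂ ∞ μ →L[ℂ] ℂ :=
  (ContinuousLinearMap.mul ℂ ℂ).lpPairing μ 1 ∞

theorem dualPairing_eq_integral (h : Lp ℂ 1 μ) (u : Lp ℂ ∞ μ) :
    dualPairing h u = ∫ ω, h ω * u ω ∂μ :=
  ContinuousLinearMap.lpPairing_eq_integral _ h u

variable [IsFiniteMeasure μ]

theorem ae_norm_le_of_forall_norm_setIntegral_le {E : Type*} [NormedAddCommGroup E]
    [InnerProductSpace ℝ E] [CompleteSpace E] [TopologicalSpace.SeparableSpace E] {v : Ω → E}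
    {C : ℝ} (hC : 0 ≤ C) (hv : Integrable v μ)
    (h : ∀ s, MeasurableSet s → ‖∫ ω in s, v ω ∂μ‖ ≤ C * μ.real s) : ∀ᵐ ω ∂μ, ‖v ω‖ ≤ C := by
  have hdir (c : E) : ∀ᵐ ω ∂μ, inner ℝ c (v ω) ≤ C * ‖c‖ := by
    refine ae_le_of_forall_setIntegral_le (hv.const_inner c) (integrable_const _) fun s hs _ => ?_
    rw [integral_inner hv.integrableOn, setIntegral_const, smul_eq_mul]
    calc inner ℝ c (∫ ω in s, v ω ∂μ) ≤ ‖c‖ * ‖∫ ω in s, v ω ∂μ‖ := real_inner_le_norm _ _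
      _ ≤ ‖c‖ * (C * μ.real s) := by gcongr; exact h s hs
      _ = μ.real s * (C * ‖c‖) := by ring
  have hdense : ∀ᵐ ω ∂μ, ∀ n, inner ℝ (TopologicalSpace.denseSeq E n) (v ω) ≤
      C * ‖TopologicalSpace.denseSeq E n‖ := ae_all_iff.2 fun n => hdir _
  filter_upwards [hdense] with ω hω
  have hself : inner ℝ (v ω) (v ω) ≤ C * ‖v ω‖ :=
    (TopologicalSpace.denseRange_denseSeq E).induction_on
      (p := fun c => inner ℝ c (v ω) ≤ C * ‖c‖) (v ω)
      (isClosed_le (by fun_prop) (by fun_prop)) hω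
  rw [real_inner_self_eq_norm_mul_norm] at hself
  rcases (norm_nonneg (v ω)).eq_or_lt with h0 | h0
  · exact h0 ▸ hC
  · exact le_of_mul_le_mul_right hself h0

/-- The inclusion `L_p ⊆ L_r` over a finite measure space, where `1/r = 1/p + 1/q`: it is the
multiplication by the constant `1 ∈ L_q`. -/
def lpInclusion (p q r : ℝ≥0∞) [Fact (1 ≤ p)] [Fact (1 ≤ q)] [Fact (1 ≤ r)]
    [ENNReal.HolderTriple p q r] : Lp ℂ p μ →L[ℂ] Lp ℂ r μ :=
  ((ContinuousLinearMap.mul ℂ ℂ).holderL μ p q r).flip (Lp.const q μ 1)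

theorem coeFn_lpInclusion (p q r : ℝ≥0∞) [Fact (1 ≤ p)] [Fact (1 ≤ q)] [Fact (1 ≤ r)]
    [ENNReal.HolderTriple p q r] (f : Lp ℂ p μ) : lpInclusion p q r f =ᵐ[μ] f := by
  filter_upwards [(ContinuousLinearMap.mul ℂ ℂ).coeFn_holder (r := r) f (Lp.const q μ (1 : ℂ)),
    Lp.coeFn_const q μ (1 : ℂ)] with ω h1 h2
  rw [h2] at h1
  exact h1.trans (mul_one _)

/-- The inclusion `L_∞ ⊆ L_2`, which carries the `L_2` geometry over to bounded functions. -/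
abbrev toL2 : Lp ℂ ∞ μ →L[ℂ] Lp ℂ 2 μ := lpInclusion ∞ 2 2

theorem inner_toL2 (f g : Lp ℂ ∞ μ) :
    inner ℂ (toL2 f) (toL2 g) = ∫ ω, star (f ω) * g ω ∂μ := by
  rw [L2.inner_def]
  refine integral_congr_ae ?_
  filter_upwards [coeFn_lpInclusion ∞ 2 2 f, coeFn_lpInclusion ∞ 2 2 g] with ω h1 h2
  simp [h1, h2, mul_comm]

theorem norm_toL2_sq (f : Lp ℂ ∞ μ) : ‖toL2 f‖ ^ 2 = ∫ ω, ‖f ω‖ ^ 2 ∂μ := by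
  rw [← inner_self_eq_norm_sq (𝕜 := ℂ), inner_toL2, ← RCLike.ofReal_re (K := ℂ) (∫ ω, _ ∂μ),
    ← integral_ofReal]
  refine congrArg _ (integral_congr_ae (ae_of_all _ fun ω => ?_))
  simp [← Complex.normSq_eq_conj_mul_self, Complex.normSq_eq_norm_sq]

theorem toL2_injective : Function.Injective (toL2 : Lp ℂ ∞ μ →L[ℂ] Lp ℂ 2 μ) := by
  refine (injective_iff_map_eq_zero _).2 fun f hf => (Lp.eq_zero_iff_ae_eq_zero).2 ?_
  exact (coeFn_lpInclusion ∞ 2 2 f).symm.trans (hf ▸ Lp.coeFn_zero ℂ 2 μ)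

theorem toL2_ne_zero_iff {f : Lp ℂ ∞ μ} : toL2 f ≠ 0 ↔ f ≠ 0 :=
  map_ne_zero_iff _ toL2_injective

theorem integral_trace_conjTranspose_mul (f g : MatLinf μ) :
    ∫ ω, ((f.toFun ω)ᴴ * g.toFun ω).trace ∂μ =
      ∑ j, ∑ i, inner ℂ (toL2 (f i j)) (toL2 (g i j)) := by
  have hint (i j) : Integrable (fun ω => star (f i j ω) * g i j ω) μ :=
    (L2.integrable_inner (𝕜 := ℂ) (toL2 (f i j)) (toL2 (g i j))).congr (by
      filter_upwards [coeFn_lpInclusion ∞ 2 2 (f i j), coeFn_lpInclusion ∞ 2 2 (g i j)]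
        with ω h1 h2
      rw [h1, h2, RCLike.inner_apply, mul_comm]
      rfl)
  simp only [Matrix.trace, Matrix.diag, Matrix.mul_apply, Matrix.conjTranspose_apply,
    MatLinf.toFun, Matrix.of_apply, inner_toL2]
  rw [integral_finsetSum _ fun j _ => integrable_finsetSum _ fun i _ => hint i j]
  exact Finset.sum_congr rfl fun j _ => integral_finsetSum _ fun i _ => hint i j

theorem dualPairing_star (f u : Lp ℂ ∞ μ) :
    dualPairing (lpInclusion ∞ 1 1 (star f)) u = inner ℂ (toL2 f) (toL2 u) := by
  rw [dualPairing_eq_integral, inner_toL2]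
  refine integral_congr_ae ?_
  filter_upwards [coeFn_lpInclusion ∞ 1 1 (star f), Lp.coeFn_star f] with ω h1 h2
  rw [h1, h2, Pi.star_apply]

theorem lpInclusion_indicatorConstLp (p q r : ℝ≥0∞) [Fact (1 ≤ p)] [Fact (1 ≤ q)] [Fact (1 ≤ r)]
    [ENNReal.HolderTriple p q r] {s : Set Ω} (hs : MeasurableSet s) (hμs : μ s ≠ ∞) (c : ℂ) :
    lpInclusion p q r (indicatorConstLp p hs hμs c) = indicatorConstLp r hs hμs c :=
  Lp.ext ((coeFn_lpInclusion p q r _).trans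
    (indicatorConstLp_coeFn.trans indicatorConstLp_coeFn.symm))

theorem exists_dualPairing_eq (Λ : Lp ℂ 1 μ →L[ℂ] ℂ) :
    ∃ u : Lp ℂ ∞ μ, ∀ h, dualPairing h u = Λ h := by
  let v : Lp ℂ 2 μ := (InnerProductSpace.toDual ℂ _).symm (Λ ∘L lpInclusion 2 2 1)
  have hv (c : ℂ) {s : Set Ω} (hs : MeasurableSet s) (hμs : μ s ≠ ∞) :
      inner ℂ (∫ ω in s, v ω ∂μ) c = Λ (indicatorConstLp 1 hs hμs c) := by
    rw [← inner_conj_symm, ← L2.inner_indicatorConstLp_eq_inner_setIntegral ℂ hs hμs c v,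
      inner_conj_symm, InnerProductSpace.toDual_symm_apply, ContinuousLinearMap.comp_apply,
      lpInclusion_indicatorConstLp]
  have hvi : Integrable v μ := (Lp.memLp v).integrable one_le_two
  have hbound : ∀ᵐ ω ∂μ, ‖v ω‖ ≤ ‖Λ‖ := by
    refine ae_norm_le_of_forall_norm_setIntegral_le (norm_nonneg _) hvi fun s hs => ?_
    have h1 : ‖∫ ω in s, v ω ∂μ‖ = ‖Λ (indicatorConstLp 1 hs (measure_ne_top μ s) 1)‖ := by
      rw [← hv, RCLike.inner_apply, one_mul, RCLike.norm_conj]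
    refine h1.trans_le ((Λ.le_opNorm _).trans_eq ?_)
    rw [norm_indicatorConstLp one_ne_zero ENNReal.one_ne_top]
    simp
  have hmem : MemLp (star v) ∞ μ :=
    memLp_top_of_bound (Lp.aestronglyMeasurable v).star ‖Λ‖ (by simpa using hbound)
  refine ⟨hmem.toLp _, fun h => ?_⟩
  induction h using Lp.induction ENNReal.one_ne_top with
  | @indicatorConst c s hs hμs =>
    rw [Lp.simpleFunc.coe_indicatorConst, ← hv, dualPairing_eq_integral, RCLike.inner_apply,
      ← integral_conj, ← integral_const_mul, ← integral_indicator hs]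
    refine integral_congr_ae ?_
    filter_upwards [indicatorConstLp_coeFn (p := 1) (hs := hs) (hμs := hμs.ne) (c := c),
      hmem.coeFn_toLp] with ω h1 h2
    by_cases hω : ω ∈ s <;> simp [h1, h2, hω]
  | add hf hg _ h1 h2 => rw [map_add, add_apply, h1, h2, map_add]
  | isClosed => exact isClosed_eq (by fun_prop) (by fun_prop)

theorem exists_weakStar_integral {F : ℝ → Lp ℂ ∞ μ} {C : ℝ}
    (hF : ∀ h, Continuous fun s => dualPairing h (F s)) (hC : ∀ s, ‖F s‖ ≤ C) (a b : ℝ) :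
    ∃ u : Lp ℂ ∞ μ, ∀ h, dualPairing h u = ∫ s in a..b, dualPairing h (F s) := by
  have hint (h : Lp ℂ 1 μ) : IntervalIntegrable (fun s => dualPairing h (F s)) volume a b :=
    (hF h).intervalIntegrable a b
  let Λ : Lp ℂ 1 μ →ₗ[ℂ] ℂ :=
    { toFun h := ∫ s in a..b, dualPairing h (F s)
      map_add' h k := by
        simp only [map_add, add_apply, intervalIntegral.integral_add (hint h) (hint k)]
      map_smul' c h := by
        simp only [map_smul, smul_apply, intervalIntegral.integral_smul, RingHom.id_apply] }
  refine exists_dualPairing_eq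
    (Λ.mkContinuous (‖(dualPairing : Lp ℂ 1 μ →L[ℂ] Lp ℂ ∞ μ →L[ℂ] ℂ)‖ * C * |b - a|) fun h => ?_)
  calc ‖Λ h‖ ≤ ‖(dualPairing : Lp ℂ 1 μ →L[ℂ] Lp ℂ ∞ μ →L[ℂ] ℂ)‖ * ‖h‖ * C * |b - a| :=
        intervalIntegral.norm_integral_le_of_norm_le_const fun s _ =>
          (ContinuousLinearMap.le_opNorm₂ _ _ _).trans (by gcongr; exact hC s)
    _ = _ := by ring

end LInfty

section SquaredModulus

variable {Ω : Type*} [MeasurableSpace Ω] {μ : Measure Ω}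

theorem eq_star_and_norm_sq_le_re {m a b : ℂ}
    (h : ∀ z : ℂ, 0 ≤ m - star z * a - z * b + ((‖z‖ ^ 2 : ℝ) : ℂ)) :
    b = star a ∧ ‖a‖ ^ 2 ≤ m.re := by
  have him (z : ℂ) : (star z * a + z * b).im = m.im := by
    have hz := (Complex.le_def.1 (h z)).2
    rw [Complex.add_im, Complex.ofReal_im, Complex.sub_im, Complex.sub_im, Complex.zero_im] at hz
    rw [Complex.add_im]
    linarith
  have hm : m.im = 0 := by simpa using (him 0).symm
  have hre : a.re = b.re := by
    have hI : -a.re + b.re = 0 := by simpa [hm] using him Complex.I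
    linarith
  have him1 : a.im + b.im = 0 := by simpa [hm] using him 1
  have hb : b = star a := Complex.ext hre.symm (by rw [Complex.star_def, Complex.conj_im]; linarith)
  refine ⟨hb, ?_⟩
  have ha := (Complex.le_def.1 (h a)).1
  have hsq : a * star a = ((‖a‖ ^ 2 : ℝ) : ℂ) := by
    rw [Complex.star_def, Complex.mul_conj, Complex.normSq_eq_norm_sq]
  rw [hb, mul_comm (star a), hsq, sub_add_cancel, Complex.sub_re, Complex.ofReal_re,
    Complex.zero_re] at ha
  linarith

/-- The squared modulus `|f|²` of a bounded function. -/
def absSq (f : Lp ℂ ∞ μ) : Lp ℂ ∞ μ :=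
  (ContinuousLinearMap.mul ℂ ℂ).holder ∞ (star f) f

theorem coeFn_absSq (f : Lp ℂ ∞ μ) : ∀ᵐ ω ∂μ, absSq f ω = ((‖f ω‖ ^ 2 : ℝ) : ℂ) := by
  filter_upwards [(ContinuousLinearMap.mul ℂ ℂ).coeFn_holder (r := ∞) (star f) f,
    Lp.coeFn_star f] with ω h1 h2
  rw [absSq, h1, h2]
  simp [← Complex.normSq_eq_conj_mul_self, Complex.normSq_eq_norm_sq]

theorem integrable_coeFn [IsFiniteMeasure μ] (f : Lp ℂ ∞ μ) : Integrable f μ :=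
  (Lp.memLp f).integrable le_top

theorem integral_absSq [IsFiniteMeasure μ] (f : Lp ℂ ∞ μ) :
    ∫ ω, absSq f ω ∂μ = ((‖toL2 f‖ ^ 2 : ℝ) : ℂ) := by
  rw [integral_congr_ae (coeFn_absSq f), integral_complex_ofReal, norm_toL2_sq]

theorem inner_toL2_one [IsFiniteMeasure μ] (f : Lp ℂ ∞ μ) :
    inner ℂ (toL2 (Lp.const ∞ μ 1)) (toL2 f) = ∫ ω, f ω ∂μ := by
  rw [inner_toL2]
  refine integral_congr_ae ?_
  filter_upwards [Lp.coeFn_const ∞ μ (1 : ℂ)] with ω hω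
  rw [hω, Function.const_apply, star_one, one_mul]

theorem const_eq_smul [IsFiniteMeasure μ] (c : ℂ) :
    Lp.const ∞ μ c = c • Lp.const ∞ μ (1 : ℂ) := by
  simpa using (Lp.constₗ ∞ μ ℂ).map_smul c (1 : ℂ)

theorem ae_nonneg_absSq_sub_sub_add [IsFiniteMeasure μ] (f : Lp ℂ ∞ μ) (c : ℂ) : ∀ᵐ ω ∂μ,
    0 ≤ (absSq f - star c • f - c • star f + Lp.const ∞ μ ((‖c‖ ^ 2 : ℝ) : ℂ) : Lp ℂ ∞ μ) ω := by
  filter_upwards [Lp.coeFn_add (absSq f - star c • f - c • star f)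
    (Lp.const ∞ μ ((‖c‖ ^ 2 : ℝ) : ℂ)), Lp.coeFn_sub (absSq f - star c • f) (c • star f),
    Lp.coeFn_sub (absSq f) (star c • f), Lp.coeFn_smul (star c) f, Lp.coeFn_smul c (star f),
    Lp.coeFn_star f, Lp.coeFn_const ∞ μ ((‖c‖ ^ 2 : ℝ) : ℂ), coeFn_absSq f]
    with ω h1 h2 h3 h4 h5 h6 h7 h8
  have hsq : ((‖f ω‖ ^ 2 : ℝ) : ℂ) - star c * f ω - c * star (f ω) + ((‖c‖ ^ 2 : ℝ) : ℂ) =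
      ((‖f ω - c‖ ^ 2 : ℝ) : ℂ) := by
    simp only [← Complex.normSq_eq_norm_sq, Complex.normSq_eq_conj_mul_self, Complex.star_def,
      map_sub]
    ring
  simp only [h1, h2, h3, h4, h5, h6, h7, h8, Pi.add_apply, Pi.sub_apply, Pi.smul_apply,
    Pi.star_apply, smul_eq_mul, Function.const_apply, hsq]
  exact Complex.zero_le_real.2 (sq_nonneg _)

end SquaredModulus

theorem tendsto_div_two_pow_zero (t : ℝ≥0) : Tendsto (fun n : ℕ => t / 2 ^ n) atTop (𝓝 0) := by
  have h : Tendsto (fun n : ℕ => t * (2⁻¹ : ℝ≥0) ^ n) atTop (𝓝 (t * 0)) :=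
    (NNReal.tendsto_pow_atTop_nhds_zero_of_lt_one (by norm_num)).const_mul t
  simpa only [inv_pow, ← div_eq_mul_inv, mul_zero] using h

namespace SymmetricMarkovSemigroup

section Contraction

variable {Ω : Type*} [MeasurableSpace Ω] {μ : Measure Ω} [IsProbabilityMeasure μ]
  (S : SymmetricMarkovSemigroup μ)

theorem T_const (t : ℝ≥0) (c : ℂ) : S.T t (Lp.const ∞ μ c) = Lp.const ∞ μ c := by
  rw [const_eq_smul, map_smul, S.unital]

/-- Apply positivity to `|f - c|²` and let `c` run through a countable dense set. -/
theorem norm_sq_T_le_re_T_absSq (t : ℝ≥0) (f : Lp ℂ ∞ μ) :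
    ∀ᵐ ω ∂μ, ‖S.T t f ω‖ ^ 2 ≤ (S.T t (absSq f) ω).re := by
  have hpos (c : ℂ) : ∀ᵐ ω ∂μ, 0 ≤ S.T t (absSq f) ω - star c * S.T t f ω
      - c * S.T t (star f) ω + ((‖c‖ ^ 2 : ℝ) : ℂ) := by
    have h := S.positive t _ (ae_nonneg_absSq_sub_sub_add f c)
    rw [_root_.map_add, map_sub, map_sub, map_smul, map_smul, S.T_const] at h
    filter_upwards [h, Lp.coeFn_add (S.T t (absSq f) - star c • S.T t f - c • S.T t (star f))
        (Lp.const ∞ μ ((‖c‖ ^ 2 : ℝ) : ℂ)),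
      Lp.coeFn_sub (S.T t (absSq f) - star c • S.T t f) (c • S.T t (star f)),
      Lp.coeFn_sub (S.T t (absSq f)) (star c • S.T t f), Lp.coeFn_smul (star c) (S.T t f),
      Lp.coeFn_smul c (S.T t (star f)),
      Lp.coeFn_const ∞ μ ((‖c‖ ^ 2 : ℝ) : ℂ)] with ω h0 h1 h2 h3 h4 h5 h6
    simpa only [h1, h2, h3, h4, h5, h6, Pi.add_apply, Pi.sub_apply, Pi.smul_apply, smul_eq_mul,
      Function.const_apply] using h0
  filter_upwards [ae_all_iff.2 fun n => hpos (TopologicalSpace.denseSeq ℂ n)] with ω hω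
  have hall (z : ℂ) : 0 ≤ S.T t (absSq f) ω - star z * S.T t f ω
      - z * S.T t (star f) ω + ((‖z‖ ^ 2 : ℝ) : ℂ) :=
    (TopologicalSpace.denseRange_denseSeq ℂ).induction_on
      (p := fun z => 0 ≤ S.T t (absSq f) ω - star z * S.T t f ω
        - z * S.T t (star f) ω + ((‖z‖ ^ 2 : ℝ) : ℂ)) z
      (isClosed_le continuous_const (by fun_prop)) hω
  exact (eq_star_and_norm_sq_le_re hall).2

theorem integral_T (t : ℝ≥0) (f : Lp ℂ ∞ μ) : ∫ ω, S.T t f ω ∂μ = ∫ ω, f ω ∂μ := by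
  rw [← inner_toL2_one, ← inner_toL2_one, inner_toL2, inner_toL2, S.symmetric, S.unital]

theorem norm_T_le (t : ℝ≥0) (f : Lp ℂ ∞ μ) : ‖S.T t f‖ ≤ ‖f‖ := by
  have hpos := S.positive t (Lp.const ∞ μ ((‖f‖ ^ 2 : ℝ) : ℂ) - absSq f) (by
    filter_upwards [Lp.coeFn_sub (Lp.const ∞ μ ((‖f‖ ^ 2 : ℝ) : ℂ)) (absSq f),
      ae_norm_le_norm f, coeFn_absSq f,
      Lp.coeFn_const ∞ μ ((‖f‖ ^ 2 : ℝ) : ℂ)] with ω h1 h2 h3 h4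
    rw [h1, Pi.sub_apply, h3, h4, Function.const_apply, sub_nonneg, Complex.real_le_real]
    gcongr)
  rw [map_sub, S.T_const] at hpos
  refine norm_le_of_ae_le (norm_nonneg f) ?_
  filter_upwards [hpos, S.norm_sq_T_le_re_T_absSq t f,
    Lp.coeFn_const ∞ μ ((‖f‖ ^ 2 : ℝ) : ℂ),
    Lp.coeFn_sub (Lp.const ∞ μ ((‖f‖ ^ 2 : ℝ) : ℂ)) (S.T t (absSq f))] with ω h1 h2 h3 h4
  rw [h4, Pi.sub_apply, h3, Function.const_apply] at h1
  have h5 := (Complex.le_def.1 h1).1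
  rw [Complex.sub_re, Complex.ofReal_re, Complex.zero_re, sub_nonneg] at h5
  exact le_of_sq_le_sq (h2.trans h5) (norm_nonneg f)

theorem norm_toL2_T_le (t : ℝ≥0) (f : Lp ℂ ∞ μ) : ‖toL2 (S.T t f)‖ ≤ ‖toL2 f‖ := by
  refine le_of_sq_le_sq ?_ (norm_nonneg _)
  have hint := integrable_coeFn (S.T t (absSq f))
  calc ‖toL2 (S.T t f)‖ ^ 2 = ∫ ω, ‖S.T t f ω‖ ^ 2 ∂μ := norm_toL2_sq _
    _ ≤ ∫ ω, (S.T t (absSq f) ω).re ∂μ :=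
      integral_mono_of_nonneg (ae_of_all _ fun _ => sq_nonneg _) hint.re
        (S.norm_sq_T_le_re_T_absSq t f)
    _ = (∫ ω, S.T t (absSq f) ω ∂μ).re := integral_re hint
    _ = ‖toL2 f‖ ^ 2 := by rw [S.integral_T, integral_absSq, Complex.ofReal_re]

theorem inner_toL2_T (t : ℝ≥0) (f g : Lp ℂ ∞ μ) :
    inner ℂ (toL2 f) (toL2 (S.T t g)) = inner ℂ (toL2 (S.T t f)) (toL2 g) := by
  rw [inner_toL2, inner_toL2, S.symmetric]

theorem T_half_T_half (t : ℝ≥0) (f : Lp ℂ ∞ μ) : S.T (t / 2) (S.T (t / 2) f) = S.T t f := by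
  rw [← LinearMap.comp_apply, ← S.map_add, add_halves]

theorem inner_toL2_T_self (t : ℝ≥0) (f : Lp ℂ ∞ μ) :
    inner ℂ (toL2 f) (toL2 (S.T t f)) = ((‖toL2 (S.T (t / 2) f)‖ ^ 2 : ℝ) : ℂ) := by
  rw [← S.T_half_T_half, S.inner_toL2_T, inner_self_eq_norm_sq_to_K, Complex.ofReal_pow]
  rfl

theorem continuous_dualPairing_T (h : Lp ℂ 1 μ) (f : Lp ℂ ∞ μ) :
    Continuous fun t => dualPairing h (S.T t f) := by
  simpa only [dualPairing_eq_integral] using S.continuous_weakStar f h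

theorem continuous_inner_toL2_T (f g : Lp ℂ ∞ μ) :
    Continuous fun t => inner ℂ (toL2 f) (toL2 (S.T t g)) := by
  simpa only [dualPairing_star] using
    S.continuous_dualPairing_T (lpInclusion ∞ 1 1 (star f)) g

theorem T_injective (t : ℝ≥0) : Function.Injective (S.T t) := by
  refine (injective_iff_map_eq_zero _).2 fun u hu => ?_
  have hhalf (n : ℕ) : S.T (t / 2 ^ n) u = 0 := by
    induction n with
    | zero => simpa using hu
    | succ n ih =>
      have h := S.inner_toL2_T_self (t / 2 ^ n) u
      rw [ih, _root_.map_zero, inner_zero_right, eq_comm, Complex.ofReal_eq_zero, sq_eq_zero_iff,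
        norm_eq_zero, div_div, ← pow_succ] at h
      exact toL2_injective (h.trans (_root_.map_zero _).symm)
  have h0 := ((S.continuous_inner_toL2_T u u).tendsto 0).comp (tendsto_div_two_pow_zero t)
  simp only [Function.comp_def, hhalf, _root_.map_zero, inner_zero_right, S.map_zero,
    LinearMap.id_apply, tendsto_const_nhds_iff] at h0
  exact toL2_injective ((inner_self_eq_zero.1 h0.symm).trans (_root_.map_zero _).symm)

end Contraction

section Generator

variable {Ω : Type*} [MeasurableSpace Ω] {μ : Measure Ω} [IsProbabilityMeasure μ]
  (S : SymmetricMarkovSemigroup μ)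

theorem exists_orbitIntegral (f : Lp ℂ ∞ μ) (a b : ℝ) : ∃ u : Lp ℂ ∞ μ,
    ∀ h, dualPairing h u = ∫ s in a..b, dualPairing h (S.T s.toNNReal f) :=
  exists_weakStar_integral
    (fun h => (S.continuous_dualPairing_T h f).comp continuous_real_toNNReal)
    (fun _ => S.norm_T_le _ f) a b

/-- The weak-* integral `∫_a^b T_s f ds`, for `0 ≤ a ≤ b`; averages of this kind provide elements
of the domain of the generator. -/
def orbitIntegral (f : Lp ℂ ∞ μ) (a b : ℝ) : Lp ℂ ∞ μ := (S.exists_orbitIntegral f a b).choose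

theorem dualPairing_orbitIntegral (h : Lp ℂ 1 μ) (f : Lp ℂ ∞ μ) (a b : ℝ) :
    dualPairing h (S.orbitIntegral f a b) = ∫ s in a..b, dualPairing h (S.T s.toNNReal f) :=
  (S.exists_orbitIntegral f a b).choose_spec h

theorem inner_toL2_orbitIntegral (k f : Lp ℂ ∞ μ) (a b : ℝ) :
    inner ℂ (toL2 k) (toL2 (S.orbitIntegral f a b)) =
      ∫ s in a..b, inner ℂ (toL2 k) (toL2 (S.T s.toNNReal f)) := by
  simp only [← dualPairing_star, dualPairing_orbitIntegral]

theorem T_orbitIntegral (t : ℝ≥0) (f : Lp ℂ ∞ μ) {a b : ℝ} (ha : 0 ≤ a) (hb : 0 ≤ b) :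
    S.T t (S.orbitIntegral f a b) = S.orbitIntegral f (a + t) (b + t) := by
  have hinner (k : Lp ℂ ∞ μ) : inner ℂ (toL2 k) (toL2 (S.T t (S.orbitIntegral f a b))) =
      inner ℂ (toL2 k) (toL2 (S.orbitIntegral f (a + t) (b + t))) := by
    rw [S.inner_toL2_T, S.inner_toL2_orbitIntegral, S.inner_toL2_orbitIntegral,
      ← intervalIntegral.integral_comp_add_right _ (t : ℝ)]
    refine intervalIntegral.integral_congr fun s hs => ?_
    have hs0 : 0 ≤ s := (le_min ha hb).trans hs.1
    rw [← S.inner_toL2_T, ← LinearMap.comp_apply, ← S.map_add, Real.toNNReal_add hs0 t.coe_nonneg,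
      Real.toNNReal_coe, add_comm t]
  refine sub_eq_zero.1 (toL2_injective ((inner_self_eq_zero (𝕜 := ℂ).1 ?_).trans
    (_root_.map_zero _).symm))
  rw [_root_.map_sub, inner_sub_right, ← _root_.map_sub, hinner, sub_self]

theorem dualPairing_sub_T_orbitIntegral (h : Lp ℂ 1 μ) (f : Lp ℂ ∞ μ) (t : ℝ≥0) :
    dualPairing h (S.orbitIntegral f 0 1 - S.T t (S.orbitIntegral f 0 1)) =
      (∫ s in (0 : ℝ)..t, dualPairing h (S.T s.toNNReal f)) -
        ∫ s in (1 : ℝ)..1 + t, dualPairing h (S.T s.toNNReal f) := by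
  have hint (a b : ℝ) : IntervalIntegrable (fun s : ℝ => dualPairing h (S.T s.toNNReal f))
      volume a b :=
    ((S.continuous_dualPairing_T h f).comp continuous_real_toNNReal).intervalIntegrable a b
  rw [S.T_orbitIntegral t f le_rfl zero_le_one, _root_.map_sub, S.dualPairing_orbitIntegral,
    S.dualPairing_orbitIntegral, zero_add,
    ← intervalIntegral.integral_add_adjacent_intervals (hint 0 t) (hint t 1),
    ← intervalIntegral.integral_add_adjacent_intervals (hint t 1) (hint 1 (1 + t))]
  ring

theorem isGenerator_iff {f g : Lp ℂ ∞ μ} : S.IsGenerator f g ↔ ∀ h : Lp ℂ 1 μ,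
    Tendsto (fun t : ℝ≥0 => ((t : ℝ) : ℂ)⁻¹ * dualPairing h (f - S.T t f)) (𝓝[>] 0)
      (𝓝 (dualPairing h g)) := by
  have hsub (h : Lp ℂ 1 μ) (t : ℝ≥0) :
      ∫ ω, h ω * (f ω - S.T t f ω) ∂μ = dualPairing h (f - S.T t f) := by
    rw [dualPairing_eq_integral]
    refine integral_congr_ae ?_
    filter_upwards [Lp.coeFn_sub f (S.T t f)] with ω hω
    rw [hω, Pi.sub_apply]
  simp only [IsGenerator, hsub, dualPairing_eq_integral]

theorem isGenerator_orbitIntegral (f : Lp ℂ ∞ μ) :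
    S.IsGenerator (S.orbitIntegral f 0 1) (f - S.T 1 f) := by
  refine S.isGenerator_iff.2 fun h => ?_
  let F : ℝ → ℂ := fun s => dualPairing h (S.T s.toNNReal f)
  have hF : Continuous F := (S.continuous_dualPairing_T h f).comp continuous_real_toNNReal
  have hderiv : HasDerivAt (fun t => (∫ s in (0 : ℝ)..t, F s) - ∫ s in (1 : ℝ)..1 + t, F s)
      (F 0 - F 1) 0 := by
    have hright : HasDerivAt (fun t => ∫ s in (1 : ℝ)..t, F s) (F 1) (1 + 0) :=
      (add_zero (1 : ℝ)).symm ▸ (hF.integral_hasStrictDerivAt 1 1).hasDerivAt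
    exact (hF.integral_hasStrictDerivAt 0 0).hasDerivAt.sub (hright.comp_const_add 1 0)
  have hlim : Tendsto (fun t : ℝ≥0 => (t : ℝ)) (𝓝[>] 0) (𝓝[>] 0) :=
    tendsto_nhdsWithin_iff.2 ⟨(NNReal.continuous_coe.tendsto 0).mono_left nhdsWithin_le_nhds,
      eventually_mem_nhdsWithin.mono fun _ ht => NNReal.coe_pos.2 ht⟩
  have hslope := hderiv.tendsto_slope_zero_right.comp hlim
  simp only [F, Real.toNNReal_zero, Real.toNNReal_one, S.map_zero, LinearMap.id_apply,
    ← _root_.map_sub] at hslope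
  refine hslope.congr fun t => ?_
  rw [S.dualPairing_sub_T_orbitIntegral]
  simp

theorem integral_orbitIntegral (f : Lp ℂ ∞ μ) (a b : ℝ) :
    ∫ ω, S.orbitIntegral f a b ω ∂μ = (b - a) • ∫ ω, f ω ∂μ := by
  simp only [← inner_toL2_one, S.inner_toL2_orbitIntegral]
  simp only [inner_toL2_one, S.integral_T, intervalIntegral.integral_const]

theorem orbitIntegral_ne_zero {f : Lp ℂ ∞ μ} (hf : f ≠ 0) : S.orbitIntegral f 0 1 ≠ 0 := by
  have hcont : Continuous fun s : ℝ => ‖toL2 (S.T (s.toNNReal / 2) f)‖ ^ 2 := by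
    have h := (Complex.continuous_re.comp (S.continuous_inner_toL2_T f f)).comp
      continuous_real_toNNReal
    simpa only [Function.comp_def, S.inner_toL2_T_self, Complex.ofReal_re] using h
  have hpos : 0 < ∫ s in (0 : ℝ)..1, ‖toL2 (S.T (s.toNNReal / 2) f)‖ ^ 2 := by
    refine intervalIntegral.integral_pos zero_lt_one hcont.continuousOn
      (fun _ _ => sq_nonneg _) ⟨0, by simp, ?_⟩
    rw [Real.toNNReal_zero, zero_div, S.map_zero, LinearMap.id_apply]
    exact sq_pos_of_pos (norm_pos_iff.2 (toL2_ne_zero_iff.2 hf))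
  intro h0
  have h := S.inner_toL2_orbitIntegral f f 0 1
  simp only [h0, _root_.map_zero, inner_zero_right, S.inner_toL2_T_self,
    intervalIntegral.integral_ofReal] at h
  exact hpos.ne (Complex.ofReal_eq_zero.1 h.symm).symm

end Generator

end SymmetricMarkovSemigroup

section Nontrivial

variable {Ω : Type*} [MeasurableSpace Ω] {μ : Measure Ω} [IsProbabilityMeasure μ]

theorem exists_ne_zero_integral_eq_zero {X : Set Ω} (hX : MeasurableSet X) (hX0 : 0 < μ X)
    (hX1 : μ X < 1) : ∃ f : Lp ℂ ∞ μ, f ≠ 0 ∧ ∫ ω, f ω ∂μ = 0 := by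
  let f : Lp ℂ ∞ μ := indicatorConstLp ∞ hX (measure_ne_top μ X) 1 - Lp.const ∞ μ (μ.real X : ℂ)
  have hf : ∀ᵐ ω ∂μ, f ω = X.indicator (fun _ => (1 : ℂ)) ω - (μ.real X : ℂ) := by
    filter_upwards [indicatorConstLp_coeFn (p := ∞) (hs := hX) (hμs := measure_ne_top μ X)
      (c := (1 : ℂ)), Lp.coeFn_const ∞ μ (μ.real X : ℂ), Lp.coeFn_sub
        (indicatorConstLp ∞ hX (measure_ne_top μ X) 1) (Lp.const ∞ μ (μ.real X : ℂ))]
      with ω h1 h2 h3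
    rw [h3, Pi.sub_apply, h1, h2, Function.const_apply]
  refine ⟨f, fun h0 => ?_, ?_⟩
  · have hnotMem : ∀ᵐ ω ∂μ, ω ∉ X := by
      filter_upwards [hf, Lp.coeFn_zero ℂ ∞ μ] with ω h1 h2 h3
      rw [h0, h2, Pi.zero_apply, Set.indicator_of_mem h3, eq_comm, sub_eq_zero, eq_comm,
        Complex.ofReal_eq_one] at h1
      exact hX1.ne (by rw [← ofReal_measureReal, h1, ENNReal.ofReal_one])
    exact hX0.ne' (measure_eq_zero_iff_ae_notMem.2 hnotMem)
  · rw [integral_congr_ae hf, integral_sub ((integrable_const _).indicator hX) (integrable_const _),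
      integral_indicator hX]
    simp

end Nontrivial

namespace SymmetricMarkovSemigroup

theorem exists_isGenerator_integral_eq_zero {Ω : Type*} [MeasurableSpace Ω] {μ : Measure Ω}
    [IsProbabilityMeasure μ] (S : SymmetricMarkovSemigroup μ)
    (hμ : ∃ X : Set Ω, MeasurableSet X ∧ 0 < μ X ∧ μ X < 1) :
    ∃ u g : Lp ℂ ∞ μ, S.IsGenerator u g ∧ ∫ ω, u ω ∂μ = 0 ∧ u ≠ 0 := by
  obtain ⟨X, hX, hX0, hX1⟩ := hμ
  obtain ⟨f, hf0, hf⟩ := exists_ne_zero_integral_eq_zero hX hX0 hX1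
  refine ⟨_, _, S.isGenerator_orbitIntegral f, ?_, S.orbitIntegral_ne_zero hf0⟩
  rw [S.integral_orbitIntegral, hf, smul_zero]

section Dirichlet

variable {Ω : Type*} [MeasurableSpace Ω] {μ : Measure Ω} [IsProbabilityMeasure μ]
  (S : SymmetricMarkovSemigroup μ)

/-- The difference quotient `t⁻¹ ⟪u, u - T_t u⟫`, whose limit at `0+` is the scalar Dirichlet
form of `u`. -/
def dirichletQuotient (t : ℝ≥0) (u : Lp ℂ ∞ μ) : ℝ :=
  (t : ℝ)⁻¹ * (inner ℂ (toL2 u) (toL2 (u - S.T t u))).re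

theorem dirichletQuotient_eq (t : ℝ≥0) (u : Lp ℂ ∞ μ) :
    S.dirichletQuotient t u = (t : ℝ)⁻¹ * (‖toL2 u‖ ^ 2 - ‖toL2 (S.T (t / 2) u)‖ ^ 2) := by
  rw [dirichletQuotient, _root_.map_sub, inner_sub_right, S.inner_toL2_T_self, Complex.sub_re,
    Complex.ofReal_re, ← inner_self_eq_norm_sq (𝕜 := ℂ) (toL2 u)]
  rfl

theorem dirichletQuotient_nonneg (t : ℝ≥0) (u : Lp ℂ ∞ μ) : 0 ≤ S.dirichletQuotient t u := by
  rw [S.dirichletQuotient_eq]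
  have h := S.norm_toL2_T_le (t / 2) u
  exact mul_nonneg (inv_nonneg.2 t.coe_nonneg) (sub_nonneg.2 (by gcongr))

/-- With `w = T_{t/2} u`, the inequality is `0 ≤ ‖u - w‖²`. -/
theorem dirichletQuotient_le_half (t : ℝ≥0) (u : Lp ℂ ∞ μ) :
    S.dirichletQuotient t u ≤ S.dirichletQuotient (t / 2) u := by
  have hsq : ‖toL2 u - toL2 (S.T (t / 2) u)‖ ^ 2 = ‖toL2 u‖ ^ 2
      - 2 * (inner ℂ (toL2 u) (toL2 (S.T (t / 2) u))).re + ‖toL2 (S.T (t / 2) u)‖ ^ 2 :=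
    norm_sub_sq (𝕜 := ℂ) _ _
  have hself : (inner ℂ (toL2 u) (toL2 u)).re = ‖toL2 u‖ ^ 2 :=
    inner_self_eq_norm_sq (𝕜 := ℂ) _
  rw [S.dirichletQuotient_eq, dirichletQuotient, _root_.map_sub, inner_sub_right, Complex.sub_re,
    hself, NNReal.coe_div, NNReal.coe_ofNat, inv_div, div_eq_inv_mul (2 : ℝ), mul_assoc]
  refine mul_le_mul_of_nonneg_left ?_ (inv_nonneg.2 t.coe_nonneg)
  linarith [sq_nonneg ‖toL2 u - toL2 (S.T (t / 2) u)‖]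

variable {S}

theorem IsGenerator.tendsto_dirichletQuotient {u g : Lp ℂ ∞ μ} (h : S.IsGenerator u g) :
    Tendsto (fun t => S.dirichletQuotient t u) (𝓝[>] 0)
      (𝓝 (inner ℂ (toL2 u) (toL2 g)).re) := by
  have hlim := S.isGenerator_iff.1 h (lpInclusion ∞ 1 1 (star u))
  simp only [dualPairing_star] at hlim
  refine ((Complex.continuous_re.tendsto _).comp hlim).congr fun t => ?_
  rw [Function.comp_apply, ← Complex.ofReal_inv, Complex.re_ofReal_mul, dirichletQuotient]

theorem IsGenerator.re_inner_nonneg {u g : Lp ℂ ∞ μ} (h : S.IsGenerator u g) :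
    0 ≤ (inner ℂ (toL2 u) (toL2 g)).re :=
  ge_of_tendsto h.tendsto_dirichletQuotient
    (Eventually.of_forall fun t => S.dirichletQuotient_nonneg t u)

theorem IsGenerator.dirichletQuotient_le {u g : Lp ℂ ∞ μ} (h : S.IsGenerator u g) {t : ℝ≥0}
    (ht : 0 < t) : S.dirichletQuotient t u ≤ (inner ℂ (toL2 u) (toL2 g)).re := by
  have hmono (n : ℕ) : S.dirichletQuotient t u ≤ S.dirichletQuotient (t / 2 ^ n) u := by
    induction n with
    | zero => simp
    | succ n ih =>
      rw [pow_succ, ← div_div]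
      exact ih.trans (S.dirichletQuotient_le_half _ u)
  have hlim : Tendsto (fun n : ℕ => t / 2 ^ n) atTop (𝓝[>] 0) :=
    tendsto_nhdsWithin_iff.2 ⟨tendsto_div_two_pow_zero t,
      Eventually.of_forall fun n => div_pos ht (by positivity)⟩
  exact ge_of_tendsto (h.tendsto_dirichletQuotient.comp hlim) (Eventually.of_forall hmono)

theorem IsGenerator.smul {u g : Lp ℂ ∞ μ} (h : S.IsGenerator u g) (c : ℂ) :
    S.IsGenerator (c • u) (c • g) := by
  refine S.isGenerator_iff.2 fun k => ?_
  rw [map_smul, smul_eq_mul]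
  refine ((S.isGenerator_iff.1 h k).const_mul c).congr fun t => ?_
  rw [map_smul, ← smul_sub, map_smul, smul_eq_mul]
  ring

theorem isGenerator_zero_of_fixed {u : Lp ℂ ∞ μ} (hu : ∀ t, S.T t u = u) : S.IsGenerator u 0 :=
  S.isGenerator_iff.2 fun k => by simp only [hu, sub_self, _root_.map_zero, mul_zero,
    tendsto_const_nhds]

theorem energy_eq_iSup_dirichletQuotient (f : MatLinf μ) : S.energy f =
    ⨆ (t : ℝ≥0) (_ : 0 < t), ENNReal.ofReal (∑ j, ∑ i, S.dirichletQuotient t (f i j)) := by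
  refine iSup_congr fun t => iSup_congr fun _ => congrArg ENNReal.ofReal ?_
  have hsub : (fun ω => f.toFun ω - (S.amp t f).toFun ω) =ᵐ[μ] (f - S.amp t f).toFun := by
    have hij : ∀ᵐ ω ∂μ, ∀ i j, (f i j - S.T t (f i j) : Lp ℂ ∞ μ) ω =
        f i j ω - S.T t (f i j) ω :=
      ae_all_iff.2 fun i => ae_all_iff.2 fun j => Lp.coeFn_sub _ _
    filter_upwards [hij] with ω hω
    ext i j
    exact (hω i j).symm
  have htrace : ∫ ω, ((f.toFun ω)ᴴ * (f.toFun ω - (S.amp t f).toFun ω)).trace ∂μ =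
      ∫ ω, ((f.toFun ω)ᴴ * (f - S.amp t f).toFun ω).trace ∂μ :=
    integral_congr_ae (hsub.mono fun ω hω => congrArg (fun A => ((f.toFun ω)ᴴ * A).trace) hω)
  simp only [htrace, integral_trace_conjTranspose_mul, Complex.re_sum, Finset.mul_sum]
  rfl

theorem IsMatGenerator.re_integral_nonneg {f g : MatLinf μ} (h : S.IsMatGenerator f g) :
    0 ≤ (∫ ω, ((f.toFun ω)ᴴ * g.toFun ω).trace ∂μ).re := by
  simp only [integral_trace_conjTranspose_mul, Complex.re_sum]
  exact Finset.sum_nonneg fun j _ => Finset.sum_nonneg fun i _ => (h i j).re_inner_nonneg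

theorem IsMatGenerator.energy_le {f g : MatLinf μ} (h : S.IsMatGenerator f g) :
    S.energy f ≤ ENNReal.ofReal (∫ ω, ((f.toFun ω)ᴴ * g.toFun ω).trace ∂μ).re := by
  rw [energy_eq_iSup_dirichletQuotient]
  refine iSup₂_le fun t ht => ENNReal.ofReal_le_ofReal ?_
  simp only [integral_trace_conjTranspose_mul, Complex.re_sum]
  exact Finset.sum_le_sum fun j _ => Finset.sum_le_sum fun i _ => (h i j).dirichletQuotient_le ht

theorem matDom_subset_dirichletAlgebra : S.matDom ⊆ S.dirichletAlgebra :=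
  fun _ ⟨_, h⟩ => h.energy_le.trans_lt ENNReal.ofReal_lt_top

end Dirichlet

end SymmetricMarkovSemigroup

section HermitianCalculus

theorem sum_norm_sq_apply_eq_one {m n : Type*} [Fintype n] [DecidableEq m]
    {W : Matrix n m ℂ} (hW : Wᴴ * W = 1) (i : m) : ∑ j, ‖W j i‖ ^ 2 = 1 := by
  have h : (∑ j, star (W j i) * W j i).re = 1 := by
    simpa [Matrix.mul_apply] using congr_arg (fun B : Matrix m m ℂ => (B i i).re) hW
  simpa [Complex.conj_mul', ← Complex.ofReal_pow] using h

variable {m n : Type*} [Fintype n] [DecidableEq n] {A : Matrix n n ℂ} {φ : ℝ → ℝ}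

theorem re_conjTranspose_mul_cfc_mul_apply (hA : A.IsHermitian) (φ : ℝ → ℝ) (U : Matrix n m ℂ)
    (i : m) : ((Uᴴ * cfc φ A * U) i i).re =
      ∑ j, ‖((hA.eigenvectorUnitary : Matrix n n ℂ)ᴴ * U) j i‖ ^ 2 * φ (hA.eigenvalues j) := by
  set W : Matrix n m ℂ := (hA.eigenvectorUnitary : Matrix n n ℂ)ᴴ * U with hW
  have hdiag : Uᴴ * cfc φ A * U =
      Wᴴ * (Matrix.diagonal fun j => (φ (hA.eigenvalues j) : ℂ)) * W := by
    rw [hA.cfc_eq, Matrix.IsHermitian.cfc, Unitary.conjStarAlgAut_apply, hW,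
      Matrix.conjTranspose_mul, Matrix.conjTranspose_conjTranspose]
    simp only [Matrix.mul_assoc, Matrix.star_eq_conjTranspose]
    rfl
  rw [hdiag, Matrix.mul_apply, Complex.re_sum]
  refine Finset.sum_congr rfl fun j _ => ?_
  rw [Matrix.mul_diagonal, Matrix.conjTranspose_apply, mul_right_comm, Complex.star_def,
    Complex.conj_mul', ← Complex.ofReal_pow, ← Complex.ofReal_mul, Complex.ofReal_re]

theorem sum_norm_sq_eigenvectorUnitary_mul_eq_one (hA : A.IsHermitian) [DecidableEq m]
    {U : Matrix n m ℂ} (hU : Uᴴ * U = 1) (i : m) :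
    ∑ j, ‖((hA.eigenvectorUnitary : Matrix n n ℂ)ᴴ * U) j i‖ ^ 2 = 1 := by
  refine sum_norm_sq_apply_eq_one ?_ i
  rw [Matrix.conjTranspose_mul, Matrix.conjTranspose_conjTranspose, Matrix.mul_assoc,
    ← Matrix.mul_assoc (hA.eigenvectorUnitary : Matrix n n ℂ), ← Matrix.star_eq_conjTranspose,
    Unitary.mul_star_self_of_mem hA.eigenvectorUnitary.2, Matrix.one_mul, hU]

theorem re_conjTranspose_mul_mul_apply (hA : A.IsHermitian) (U : Matrix n m ℂ) (i : m) :
    ((Uᴴ * A * U) i i).re =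
      ∑ j, ‖((hA.eigenvectorUnitary : Matrix n n ℂ)ᴴ * U) j i‖ ^ 2 * hA.eigenvalues j := by
  simpa only [cfc_id ℝ A, id] using re_conjTranspose_mul_cfc_mul_apply hA id U i

theorem re_conjTranspose_mul_mul_apply_mem (hA : A.IsHermitian) {s : Set ℝ} (hs : Convex ℝ s)
    (hspec : spectrum ℝ A ⊆ s) [DecidableEq m] {U : Matrix n m ℂ} (hU : Uᴴ * U = 1) (i : m) :
    ((Uᴴ * A * U) i i).re ∈ s := by
  rw [re_conjTranspose_mul_mul_apply hA]
  exact hs.sum_mem (fun _ _ => sq_nonneg _) (sum_norm_sq_eigenvectorUnitary_mul_eq_one hA hU i)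
    fun j _ => hspec (hA.eigenvalues_mem_spectrum_real j)

theorem posSemidef_iff_isHermitian_and_spectrum_real_subset :
    A.PosSemidef ↔ A.IsHermitian ∧ spectrum ℝ A ⊆ Set.Ici 0 := by
  refine ⟨fun h => ⟨h.isHermitian, ?_⟩, fun h => h.1.posSemidef_iff_eigenvalues_nonneg.2
    fun i => h.2 (h.1.eigenvalues_mem_spectrum_real i)⟩
  rw [h.isHermitian.spectrum_real_eq_range_eigenvalues]
  exact Set.range_subset_iff.2 h.eigenvalues_nonneg

/-- The diagonal entry is an average of the eigenvalues. -/
theorem map_re_conjTranspose_mul_mul_apply_le (hA : A.IsHermitian) {s : Set ℝ}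
    (hφ : ConvexOn ℝ s φ) (hspec : spectrum ℝ A ⊆ s) [DecidableEq m] {U : Matrix n m ℂ}
    (hU : Uᴴ * U = 1) (i : m) :
    φ ((Uᴴ * A * U) i i).re ≤ ((Uᴴ * cfc φ A * U) i i).re := by
  rw [re_conjTranspose_mul_mul_apply hA, re_conjTranspose_mul_cfc_mul_apply hA]
  exact hφ.map_sum_le (fun _ _ => sq_nonneg _) (sum_norm_sq_eigenvectorUnitary_mul_eq_one hA hU i)
    fun j _ => hspec (hA.eigenvalues_mem_spectrum_real j)

theorem trace_conjTranspose_mul_mul_of_mul_conjTranspose (B : Matrix n n ℂ) {U : Matrix n n ℂ}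
    (hU : U * Uᴴ = 1) : (Uᴴ * B * U).trace = B.trace := by
  rw [Matrix.trace_mul_comm, ← Matrix.mul_assoc, hU, Matrix.one_mul]

theorem sum_map_re_conjTranspose_mul_mul_apply_le_trace_cfc (hA : A.IsHermitian) {s : Set ℝ}
    (hφ : ConvexOn ℝ s φ) (hspec : spectrum ℝ A ⊆ s) {U : Matrix n n ℂ} (hU : Uᴴ * U = 1) :
    ∑ i, φ ((Uᴴ * A * U) i i).re ≤ (cfc φ A).trace.re := by
  rw [← trace_conjTranspose_mul_mul_of_mul_conjTranspose _ (mul_eq_one_comm.1 hU), Matrix.trace,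
    Complex.re_sum]
  exact Finset.sum_le_sum fun i _ => map_re_conjTranspose_mul_mul_apply_le hA hφ hspec hU i

theorem re_trace_cfc (hA : A.IsHermitian) (φ : ℝ → ℝ) :
    (cfc φ A).trace.re = ∑ i, φ (hA.eigenvalues i) := by
  rw [hA.cfc_eq, Matrix.IsHermitian.cfc, Unitary.conjStarAlgAut_apply, Matrix.trace_mul_comm,
    ← Matrix.mul_assoc, Unitary.star_mul_self_of_mem hA.eigenvectorUnitary.2, Matrix.one_mul]
  simp [Matrix.trace_diagonal]

theorem conjTranspose_eigenvectorUnitary_mul_self (hA : A.IsHermitian) :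
    (hA.eigenvectorUnitary : Matrix n n ℂ)ᴴ * hA.eigenvectorUnitary = 1 :=
  Unitary.star_mul_self_of_mem hA.eigenvectorUnitary.2

theorem re_conjTranspose_eigenvectorUnitary_mul_mul_apply (hA : A.IsHermitian) (i : n) :
    (((hA.eigenvectorUnitary : Matrix n n ℂ)ᴴ * A * hA.eigenvectorUnitary) i i).re =
      hA.eigenvalues i := by
  have h := hA.conjStarAlgAut_star_eigenvectorUnitary
  rw [Unitary.conjStarAlgAut_star_apply] at h
  rw [← Matrix.star_eq_conjTranspose, h]
  simp

/-- Klein's lemma: in the eigenbasis of a convex combination `A`, the inequality of Peierls applies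
to both of the combined matrices. -/
theorem convexOn_re_trace_cfc {s : Set ℝ} (hφ : ConvexOn ℝ s φ) :
    ConvexOn ℝ {A : Matrix n n ℂ | A.IsHermitian ∧ spectrum ℝ A ⊆ s}
      fun A => (cfc φ A).trace.re := by
  have hherm {A B : Matrix n n ℂ} (hA : A.IsHermitian) (hB : B.IsHermitian) (a b : ℝ) :
      (a • A + b • B).IsHermitian := (hA.smul (.all a)).add (hB.smul (.all b))
  have hentry (A B U : Matrix n n ℂ) (a b : ℝ) (i : n) :
      ((Uᴴ * (a • A + b • B) * U) i i).re =
        a * ((Uᴴ * A * U) i i).re + b * ((Uᴴ * B * U) i i).re := by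
    simp [Matrix.mul_add, Matrix.add_mul, Matrix.add_apply, Matrix.smul_apply]
  have hmem {A : Matrix n n ℂ} (hA : A.IsHermitian ∧ spectrum ℝ A ⊆ s) {C : Matrix n n ℂ}
      (hC : C.IsHermitian) (i : n) :
      (((hC.eigenvectorUnitary : Matrix n n ℂ)ᴴ * A * hC.eigenvectorUnitary) i i).re ∈ s :=
    re_conjTranspose_mul_mul_apply_mem hA.1 hφ.1 hA.2
      (conjTranspose_eigenvectorUnitary_mul_self hC) i
  refine ⟨fun A hA B hB a b ha hb hab => ⟨hherm hA.1 hB.1 a b, ?_⟩,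
    fun A hA B hB a b ha hb hab => ?_⟩
  all_goals have hC := hherm hA.1 hB.1 a b
  · rw [hC.spectrum_real_eq_range_eigenvalues]
    rintro _ ⟨i, rfl⟩
    rw [← re_conjTranspose_eigenvectorUnitary_mul_mul_apply hC, hentry]
    exact hφ.1 (hmem hA hC i) (hmem hB hC i) ha hb hab
  · have hU := conjTranspose_eigenvectorUnitary_mul_self hC
    calc (cfc φ (a • A + b • B)).trace.re = ∑ i, φ (hC.eigenvalues i) := re_trace_cfc hC φ
      _ ≤ ∑ i, (a * φ (((hC.eigenvectorUnitary : Matrix n n ℂ)ᴴ * A * hC.eigenvectorUnitary)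
            i i).re + b * φ (((hC.eigenvectorUnitary : Matrix n n ℂ)ᴴ * B *
            hC.eigenvectorUnitary) i i).re) := by
          refine Finset.sum_le_sum fun i _ => ?_
          rw [← re_conjTranspose_eigenvectorUnitary_mul_mul_apply hC, hentry]
          exact hφ.2 (hmem hA hC i) (hmem hB hC i) ha hb hab
      _ ≤ a * (cfc φ A).trace.re + b * (cfc φ B).trace.re := by
          rw [Finset.sum_add_distrib, ← Finset.mul_sum, ← Finset.mul_sum]
          exact add_le_add
            (mul_le_mul_of_nonneg_left
              (sum_map_re_conjTranspose_mul_mul_apply_le_trace_cfc hA.1 hφ hA.2 hU) ha)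
            (mul_le_mul_of_nonneg_left
              (sum_map_re_conjTranspose_mul_mul_apply_le_trace_cfc hB.1 hφ hB.2 hU) hb)

open scoped Matrix.Norms.L2Operator in
theorem continuousOn_cfc_isHermitian (hφ : Continuous φ) :
    ContinuousOn (cfc φ) {A : Matrix n n ℂ | A.IsHermitian} :=
  continuousOn_id.cfc_of_mem_nhdsSet (s := Set.univ) φ (by simp) (fun _ hA => hA) hφ.continuousOn

theorem continuousOn_re_trace_cfc (hφ : Continuous φ) :
    ContinuousOn (fun A => (cfc φ A).trace.re) {A : Matrix n n ℂ | A.IsHermitian} :=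
  (Complex.continuous_re.comp continuous_id.matrix_trace).comp_continuousOn
    (continuousOn_cfc_isHermitian hφ)

end HermitianCalculus

section Entropy

variable {Ω : Type*} [MeasurableSpace Ω] {μ : Measure Ω} {A : Matrix (Fin 2) (Fin 2) ℂ}
  {G : Ω → Matrix (Fin 2) (Fin 2) ℂ}

open scoped Matrix.Norms.L2Operator

theorem trLog_eq_re_trace_cfc (hA : A.IsHermitian) :
    trLog A = (cfc (fun x => x * Real.log x) A).trace.re := by
  rw [cfc_mul (fun x => x) Real.log A (hf := A.finite_real_spectrum.continuousOn _)
    (hg := A.finite_real_spectrum.continuousOn _), cfc_id' ℝ A, trLog]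

theorem convexOn_trLog : ConvexOn ℝ {A | A.PosSemidef} trLog := by
  refine ConvexOn.congr (f := fun A => (cfc (fun x => x * Real.log x) A).trace.re) ?_
    fun A hA => (trLog_eq_re_trace_cfc hA.isHermitian).symm
  simpa only [posSemidef_iff_isHermitian_and_spectrum_real_subset] using
    convexOn_re_trace_cfc Real.convexOn_mul_log

theorem continuousOn_trLog : ContinuousOn trLog {A | A.IsHermitian} :=
  (continuousOn_re_trace_cfc Real.continuous_mul_log).congr fun _ => trLog_eq_re_trace_cfc

theorem isClosed_posSemidef {n : Type*} [Finite n] :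
    IsClosed {A : Matrix n n ℂ | A.PosSemidef} := by
  cases nonempty_fintype n
  simp only [Matrix.posSemidef_iff_dotProduct_mulVec, Set.ofPred_and, Set.ofPred_forall]
  refine (isClosed_eq (by fun_prop) continuous_id).inter (isClosed_iInter fun x => ?_)
  exact isClosed_le continuous_const (by fun_prop)

theorem integrable_comp_of_memLp_top [IsFiniteMeasure μ] {E : Type*} [NormedAddCommGroup E]
    [ProperSpace E] {ψ : E → ℝ} (hψ : Continuous ψ) {X : Ω → E} (hX : MemLp X ∞ μ) :
    Integrable (fun ω => ψ (X ω)) μ := by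
  obtain ⟨K, hK⟩ := (isCompact_closedBall (0 : E) (lpNorm X ∞ μ)).exists_bound_of_continuousOn
    hψ.continuousOn
  refine Integrable.of_bound (hψ.comp_aestronglyMeasurable hX.1) K ?_
  filter_upwards [ae_le_lpNorm_exponent_top hX] with ω hω
  exact hK _ (mem_closedBall_zero_iff.2 hω)

theorem integrable_trLog [IsFiniteMeasure μ] (hG : MemLp G ∞ μ)
    (hherm : ∀ ω, (G ω).IsHermitian) : Integrable (fun ω => trLog (G ω)) μ := by
  have hcont : Continuous fun A : Matrix (Fin 2) (Fin 2) ℂ => trLog ((1 / 2 : ℝ) • (A + Aᴴ)) :=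
    continuousOn_trLog.comp_continuous (by fun_prop) fun A =>
      (Matrix.isHermitian_add_transpose_self A).smul (.all _)
  refine (integrable_comp_of_memLp_top hcont hG).congr (ae_of_all _ fun ω => ?_)
  simp only [(hherm ω).eq, ← two_smul ℝ (G ω), smul_smul]
  norm_num

theorem memLp_of_forall_memLp_apply {p : ℝ≥0∞} (hG : ∀ i j, MemLp (fun ω => G ω i j) p μ) :
    MemLp G p μ := by
  have hsum (ω : Ω) : G ω = ∑ i, ∑ j, (G ω i j) • Matrix.single i j (1 : ℂ) := by
    simpa using Matrix.matrix_eq_sum_single (G ω)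
  rw [funext hsum]
  exact memLp_finsetSum _ fun i _ => memLp_finsetSum _ fun j _ =>
    (ContinuousLinearMap.toSpanSingleton ℂ (Matrix.single i j (1 : ℂ))).comp_memLp' (hG i j)

theorem memLp_toFun (f : MatLinf μ) : MemLp f.toFun ∞ μ :=
  memLp_of_forall_memLp_apply fun i j => Lp.memLp (f i j)

theorem matMean_eq_integral (hG : Integrable G μ) : matMean μ G = ∫ ω, G ω ∂μ := by
  ext i j
  exact (Matrix.entryLinearMap ℂ ℂ i j).toContinuousLinearMap.integral_comp_comm hG

/-- This is Jensen's inequality for `trLog`. -/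
theorem matEnt_nonneg [IsProbabilityMeasure μ] (hG : MemLp G ∞ μ)
    (hpos : ∀ ω, (G ω).PosSemidef) : 0 ≤ matEnt μ G := by
  have hint : Integrable G μ := hG.integrable le_top
  rw [matEnt, sub_nonneg, matMean_eq_integral hint]
  exact convexOn_trLog.map_integral_le
    (continuousOn_trLog.mono fun _ hA => hA.isHermitian) isClosed_posSemidef
    (ae_of_all _ hpos) hint (integrable_trLog hG fun ω => (hpos ω).isHermitian)

theorem re_trace_conjTranspose_mul_self_nonneg {m n : Type*} [Fintype m] [Fintype n]
    (B : Matrix m n ℂ) : 0 ≤ (Bᴴ * B).trace.re :=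
  (Complex.le_def.1 (Matrix.posSemidef_conjTranspose_mul_self B).trace_nonneg).1

theorem normSqL2_nonneg (F : Ω → Matrix (Fin 2) (Fin 2) ℂ) : 0 ≤ normSqL2 μ F :=
  integral_nonneg fun ω => re_trace_conjTranspose_mul_self_nonneg (F ω)

theorem matEnt_sqAbs_nonneg [IsProbabilityMeasure μ] {F : Ω → Matrix (Fin 2) (Fin 2) ℂ}
    (hF : MemLp F ∞ μ) : 0 ≤ matEnt μ (sqAbs F) :=
  matEnt_nonneg (hF.mul hF.star) fun ω => Matrix.posSemidef_conjTranspose_mul_self (F ω)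

namespace SymmetricMarkovSemigroup

variable [IsProbabilityMeasure μ] (S : SymmetricMarkovSemigroup μ)

theorem rothaus_zero (C : Set (MatLinf μ)) : S.Rothaus C 0 := fun f _ => by
  rw [zero_mul]
  exact add_nonneg (matEnt_sqAbs_nonneg ((memLp_toFun f).sub (memLp_const _)))
    (normSqL2_nonneg _)

theorem logSobolevForm_zero : S.LogSobolevForm 0 := fun f _ => by
  rw [zero_mul]
  positivity

theorem logSobolevGen_zero : S.LogSobolevGen 0 := fun f g h => by
  rw [zero_mul]
  exact h.re_integral_nonneg

end SymmetricMarkovSemigroup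

end Entropy

section TwoByTwo

variable {A : Matrix (Fin 2) (Fin 2) ℂ} {p q : ℝ}

theorem sum_map_eigenvalues_eq_of_trace_of_det (hA : A.IsHermitian) (htr : A.trace = (p + q : ℝ))
    (hdet : A.det = (p * q : ℝ)) (φ : ℝ → ℝ) : ∑ i, φ (hA.eigenvalues i) = φ p + φ q := by
  have hsum : hA.eigenvalues 0 + hA.eigenvalues 1 = p + q := by
    rw [hA.trace_eq_sum_eigenvalues, Fin.sum_univ_two] at htr
    exact Complex.ofReal_injective (by simpa using htr)
  have hprod : hA.eigenvalues 0 * hA.eigenvalues 1 = p * q := by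
    rw [hA.det_eq_prod_eigenvalues, Fin.prod_univ_two] at hdet
    exact Complex.ofReal_injective (by simpa using hdet)
  rw [Fin.sum_univ_two]
  have hroot : (hA.eigenvalues 0 - p) * (hA.eigenvalues 0 - q) = 0 := by
    linear_combination hA.eigenvalues 0 * hsum - hprod
  rcases mul_eq_zero.1 hroot with h | h
  · rw [sub_eq_zero.1 h, show hA.eigenvalues 1 = q by linarith]
  · rw [sub_eq_zero.1 h, show hA.eigenvalues 1 = p by linarith, add_comm]

theorem trLog_eq_of_trace_of_det (hA : A.IsHermitian) (htr : A.trace = (p + q : ℝ))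
    (hdet : A.det = (p * q : ℝ)) : trLog A = p * Real.log p + q * Real.log q := by
  rw [trLog_eq_re_trace_cfc hA, re_trace_cfc hA]
  exact sum_map_eigenvalues_eq_of_trace_of_det hA htr hdet fun x => x * Real.log x

theorem trLog_diagonal (p q : ℝ) :
    trLog !![(p : ℂ), 0; 0, (q : ℂ)] = p * Real.log p + q * Real.log q := by
  refine trLog_eq_of_trace_of_det (Matrix.IsHermitian.ext fun i j => ?_) ?_ ?_
  · fin_cases i <;> fin_cases j <;> simp
  · simp [Matrix.trace_fin_two]
  · simp [Matrix.det_fin_two]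

theorem trLog_rankOne (z : ℂ) : trLog !![1, z; star z, ((‖z‖ ^ 2 : ℝ) : ℂ)] =
    (1 + ‖z‖ ^ 2) * Real.log (1 + ‖z‖ ^ 2) := by
  have hherm : !![1, z; star z, ((‖z‖ ^ 2 : ℝ) : ℂ)].IsHermitian :=
    Matrix.IsHermitian.ext fun i j => by fin_cases i <;> fin_cases j <;> simp
  rw [trLog_eq_of_trace_of_det (p := 1 + ‖z‖ ^ 2) (q := 0) hherm, zero_mul, add_zero]
  · simp [Matrix.trace_fin_two]
  · simp [Matrix.det_fin_two, Complex.mul_conj']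

theorem conjTranspose_mul_self_row (a b : ℂ) :
    !![a, b; 0, 0]ᴴ * !![a, b; 0, 0] =
      !![((‖a‖ ^ 2 : ℝ) : ℂ), star a * b; star b * a, ((‖b‖ ^ 2 : ℝ) : ℂ)] := by
  ext i j
  fin_cases i <;> fin_cases j <;> simp [Matrix.mul_apply, Complex.conj_mul']

end TwoByTwo

theorem exists_mul_lt_mul_negMulLog {α : ℝ} (hα : 0 < α) (K : ℝ) :
    ∃ x > 0, K * x < α * Real.negMulLog x := by
  refine ⟨Real.exp (-((K + 1) / α)), Real.exp_pos _, ?_⟩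
  have h : α * Real.negMulLog (Real.exp (-((K + 1) / α))) =
      (K + 1) * Real.exp (-((K + 1) / α)) := by
    rw [Real.negMulLog, Real.log_exp]
    field_simp
  rw [h, add_mul, one_mul]
  exact lt_add_of_pos_right _ (Real.exp_pos _)

section RowFun

variable {Ω : Type*} [MeasurableSpace Ω] {μ : Measure Ω} {v : Lp ℂ ∞ μ}

section FiniteMeasure

variable [IsFiniteMeasure μ]

theorem integrable_norm_sq (v : Lp ℂ ∞ μ) : Integrable (fun ω => ‖v ω‖ ^ 2) μ :=
  integrable_comp_of_memLp_top (ψ := fun z : ℂ => ‖z‖ ^ 2) (by fun_prop) (Lp.memLp v)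

theorem integral_norm_sq_mul_log_le (v : Lp ℂ ∞ μ) :
    ∫ ω, ‖v ω‖ ^ 2 * Real.log (‖v ω‖ ^ 2) ∂μ ≤ ‖toL2 v‖ ^ 2 * Real.log (‖v‖ ^ 2) := by
  rw [norm_toL2_sq, ← integral_mul_const]
  refine integral_mono_ae (integrable_comp_of_memLp_top
    (ψ := fun z : ℂ => ‖z‖ ^ 2 * Real.log (‖z‖ ^ 2))
    (Real.continuous_mul_log.comp (by fun_prop)) (Lp.memLp v))
    ((integrable_norm_sq v).mul_const _) ?_
  filter_upwards [ae_norm_le_norm v] with ω hω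
  rcases (norm_nonneg (v ω)).eq_or_lt with h | h
  · simp [← h]
  · gcongr

theorem norm_toL2_smul_sq (c : ℂ) (v : Lp ℂ ∞ μ) :
    ‖toL2 (c • v)‖ ^ 2 = ‖c‖ ^ 2 * ‖toL2 v‖ ^ 2 := by
  rw [map_smul, norm_smul, mul_pow]

theorem integral_smul_eq_zero (hv : ∫ ω, v ω ∂μ = 0) (c : ℂ) : ∫ ω, (c • v) ω ∂μ = 0 := by
  rw [← inner_toL2_one, map_smul, inner_smul_right, inner_toL2_one, hv, mul_zero]

theorem exists_norm_toL2_smul_sq_eq (hv0 : v ≠ 0) {x : ℝ} (hx : 0 < x) :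
    ∃ c : ℂ, c ≠ 0 ∧ ‖toL2 (c • v)‖ ^ 2 = x := by
  have hv2 : toL2 v ≠ 0 := toL2_ne_zero_iff.2 hv0
  refine ⟨(√x / ‖toL2 v‖ : ℝ), ?_, ?_⟩
  · exact_mod_cast (by positivity : √x / ‖toL2 v‖ ≠ 0)
  · rw [norm_toL2_smul_sq, Complex.norm_real, Real.norm_of_nonneg (by positivity), div_pow,
      Real.sq_sqrt hx.le, div_mul_cancel₀ _ (by positivity)]

end FiniteMeasure

variable [IsProbabilityMeasure μ]

/-- The test function `e₁₁ + v e₁₂` on which the matrix-valued inequalities fail. -/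
def rowFun (v : Lp ℂ ∞ μ) : MatLinf μ := !![Lp.const ∞ μ 1, v; 0, 0]

theorem toFun_rowFun (v : Lp ℂ ∞ μ) (ω : Ω) : (rowFun v).toFun ω = !![1, v ω; 0, 0] := by
  ext i j
  fin_cases i <;> fin_cases j <;> simp [rowFun, MatLinf.toFun]

theorem sqAbs_rowFun (v : Lp ℂ ∞ μ) :
    sqAbs (rowFun v).toFun = fun ω => !![1, v ω; star (v ω), ((‖v ω‖ ^ 2 : ℝ) : ℂ)] := by
  ext1 ω
  simp [sqAbs, toFun_rowFun, conjTranspose_mul_self_row]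

theorem centered_rowFun (hv : ∫ ω, v ω ∂μ = 0) :
    centered μ (rowFun v).toFun = fun ω => !![0, v ω; 0, 0] := by
  have hmean : matMean μ (rowFun v).toFun = !![1, 0; 0, 0] := by
    ext i j
    fin_cases i <;> fin_cases j <;> simp [matMean, toFun_rowFun, hv]
  ext1 ω
  rw [centered, toFun_rowFun, hmean]
  ext i j
  fin_cases i <;> fin_cases j <;> simp

theorem sqAbs_centered_rowFun (hv : ∫ ω, v ω ∂μ = 0) :
    sqAbs (centered μ (rowFun v).toFun) = fun ω =>
      !![((0 : ℝ) : ℂ), 0; 0, ((‖v ω‖ ^ 2 : ℝ) : ℂ)] := by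
  ext1 ω
  simp [centered_rowFun hv, sqAbs, conjTranspose_mul_self_row]

theorem normSqL2_centered_rowFun (hv : ∫ ω, v ω ∂μ = 0) :
    normSqL2 μ (centered μ (rowFun v).toFun) = ‖toL2 v‖ ^ 2 := by
  rw [norm_toL2_sq]
  change ∫ ω, (sqAbs (centered μ (rowFun v).toFun) ω).trace.re ∂μ = _
  simp only [sqAbs_centered_rowFun hv, Matrix.trace_fin_two_of, Complex.ofReal_zero, zero_add,
    Complex.ofReal_re]

theorem matEnt_sqAbs_rowFun (hv : ∫ ω, v ω ∂μ = 0) : matEnt μ (sqAbs (rowFun v).toFun) =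
    ∫ ω, (1 + ‖v ω‖ ^ 2) * Real.log (1 + ‖v ω‖ ^ 2) ∂μ + Real.negMulLog (‖toL2 v‖ ^ 2) := by
  have hmean : matMean μ (fun ω => !![1, v ω; star (v ω), ((‖v ω‖ ^ 2 : ℝ) : ℂ)]) =
      !![((1 : ℝ) : ℂ), 0; 0, ((‖toL2 v‖ ^ 2 : ℝ) : ℂ)] := by
    have hconj : ∫ ω, star (v ω) ∂μ = 0 := integral_conj.trans (by rw [hv, map_zero])
    ext i j
    fin_cases i <;> fin_cases j
    · simp [matMean]
    · exact hv
    · exact hconj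
    · exact integral_complex_ofReal.trans (by rw [← norm_toL2_sq]; rfl)
  rw [sqAbs_rowFun v, matEnt, hmean, trLog_diagonal, Real.log_one, mul_zero,
    zero_add, Real.negMulLog, neg_mul, ← sub_eq_add_neg]
  simp only [trLog_rankOne]

theorem matEnt_sqAbs_centered_rowFun (hv : ∫ ω, v ω ∂μ = 0) :
    matEnt μ (sqAbs (centered μ (rowFun v).toFun)) =
      ∫ ω, ‖v ω‖ ^ 2 * Real.log (‖v ω‖ ^ 2) ∂μ + Real.negMulLog (‖toL2 v‖ ^ 2) := by
  have hmean : matMean μ (fun ω => !![((0 : ℝ) : ℂ), 0; 0, ((‖v ω‖ ^ 2 : ℝ) : ℂ)]) =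
      !![((0 : ℝ) : ℂ), 0; 0, ((‖toL2 v‖ ^ 2 : ℝ) : ℂ)] := by
    ext i j
    fin_cases i <;> fin_cases j
    any_goals simp [matMean]; done
    exact integral_complex_ofReal.trans (by rw [← norm_toL2_sq]; rfl)
  rw [sqAbs_centered_rowFun hv, matEnt, hmean, trLog_diagonal, zero_mul,
    zero_add, Real.negMulLog, neg_mul, ← sub_eq_add_neg]
  simp only [trLog_diagonal, zero_mul, zero_add]

theorem negMulLog_le_matEnt_rowFun (hv : ∫ ω, v ω ∂μ = 0) :
    Real.negMulLog (‖toL2 v‖ ^ 2) ≤ matEnt μ (sqAbs (rowFun v).toFun) := by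
  rw [matEnt_sqAbs_rowFun hv]
  refine le_add_of_nonneg_left (integral_nonneg fun ω => ?_)
  have h : 1 ≤ 1 + ‖v ω‖ ^ 2 := le_add_of_nonneg_right (sq_nonneg _)
  exact mul_nonneg (zero_le_one.trans h) (Real.log_nonneg h)

theorem matEnt_centered_rowFun_le (hv : ∫ ω, v ω ∂μ = 0) (hv0 : v ≠ 0) :
    matEnt μ (sqAbs (centered μ (rowFun v).toFun)) ≤
      ‖toL2 v‖ ^ 2 * Real.log (‖v‖ ^ 2 / ‖toL2 v‖ ^ 2) := by
  have hv2 : toL2 v ≠ 0 := toL2_ne_zero_iff.2 hv0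
  rw [matEnt_sqAbs_centered_rowFun hv, Real.log_div (by positivity) (by positivity), mul_sub,
    Real.negMulLog, neg_mul, ← sub_eq_add_neg]
  exact sub_le_sub_right (integral_norm_sq_mul_log_le v) _

/-- Entropy beats any quadratic quantity, since `x log x` is not `O(x)` at `0`. -/
theorem nonpos_of_forall_mul_matEnt_rowFun_smul_le (hv : ∫ ω, v ω ∂μ = 0) (hv0 : v ≠ 0)
    {α K : ℝ} (h : ∀ c : ℂ, c ≠ 0 → α * matEnt μ (sqAbs (rowFun (c • v)).toFun) ≤ ‖c‖ ^ 2 * K) :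
    α ≤ 0 := by
  by_contra! hα
  have hv2 : toL2 v ≠ 0 := toL2_ne_zero_iff.2 hv0
  obtain ⟨x, hx, hlt⟩ := exists_mul_lt_mul_negMulLog hα (K / ‖toL2 v‖ ^ 2)
  obtain ⟨c, hc, hcx⟩ := exists_norm_toL2_smul_sq_eq hv0 hx
  refine hlt.not_ge ?_
  calc α * Real.negMulLog x ≤ α * matEnt μ (sqAbs (rowFun (c • v)).toFun) := by
        rw [← hcx]
        exact mul_le_mul_of_nonneg_left
          (negMulLog_le_matEnt_rowFun (integral_smul_eq_zero hv c)) hα.le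
    _ ≤ ‖c‖ ^ 2 * K := h c hc
    _ = K / ‖toL2 v‖ ^ 2 * x := by
        rw [← hcx, norm_toL2_smul_sq]
        field_simp

namespace SymmetricMarkovSemigroup

variable (S : SymmetricMarkovSemigroup μ)

theorem amp_rowFun (t : ℝ≥0) (v : Lp ℂ ∞ μ) : S.amp t (rowFun v) = rowFun (S.T t v) := by
  ext1 i j
  fin_cases i <;> fin_cases j <;> simp [amp, rowFun, S.T_const]

variable {S} {u g : Lp ℂ ∞ μ}

theorem IsGenerator.isMatGenerator_rowFun (h : S.IsGenerator u g) :
    S.IsMatGenerator (rowFun u) !![0, g; 0, 0] := by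
  have hzero : S.IsGenerator 0 0 := isGenerator_zero_of_fixed fun t => _root_.map_zero _
  intro i j
  fin_cases i <;> fin_cases j
  · exact isGenerator_zero_of_fixed fun t => S.T_const t 1
  · exact h
  · exact hzero
  · exact hzero

theorem IsGenerator.rowFun_mem_matDom (h : S.IsGenerator u g) : rowFun u ∈ S.matDom :=
  ⟨_, h.isMatGenerator_rowFun⟩

theorem re_integral_trace_rowFun_smul (u g : Lp ℂ ∞ μ) (c : ℂ) :
    (∫ ω, (((rowFun (c • u)).toFun ω)ᴴ *
      MatLinf.toFun (μ := μ) !![0, c • g; 0, 0] ω).trace ∂μ).re =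
      ‖c‖ ^ 2 * (inner ℂ (toL2 u) (toL2 g)).re := by
  rw [integral_trace_conjTranspose_mul, ← Complex.re_ofReal_mul]
  simp only [rowFun, Fin.sum_univ_two, Matrix.of_apply, Matrix.cons_val', Matrix.cons_val_zero,
    Matrix.cons_val_one, Matrix.cons_val_fin_one, _root_.map_zero, inner_zero_right, zero_add,
    add_zero, map_smul, inner_smul_left, inner_smul_right]
  rw [← mul_assoc, Complex.ofReal_pow, Complex.mul_conj']

theorem rothaus_nonpos {C : Set (MatLinf μ)} (hu : ∫ ω, u ω ∂μ = 0) (hu0 : u ≠ 0)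
    (hC : ∀ c : ℂ, rowFun (c • u) ∈ C) {α : ℝ} (h : S.Rothaus C α) : α ≤ 0 := by
  refine nonpos_of_forall_mul_matEnt_rowFun_smul_le hu hu0
    (K := ‖toL2 u‖ ^ 2 * Real.log (‖u‖ ^ 2 / ‖toL2 u‖ ^ 2) + ‖toL2 u‖ ^ 2)
    fun c hc => (h _ (hC c)).trans ?_
  have hcu := integral_smul_eq_zero hu c
  rw [normSqL2_centered_rowFun hcu]
  refine (add_le_add_left (matEnt_centered_rowFun_le hcu (smul_ne_zero hc hu0)) _).trans_eq ?_
  rw [norm_toL2_smul_sq, norm_smul, mul_pow, mul_div_mul_left _ _ (by positivity)]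
  ring

theorem logSobolevForm_nonpos (hu : ∫ ω, u ω ∂μ = 0) (hu0 : u ≠ 0) (hg : S.IsGenerator u g)
    {α : ℝ} (h : S.LogSobolevForm α) : α ≤ 0 := by
  refine nonpos_of_forall_mul_matEnt_rowFun_smul_le hu hu0
    (K := 2 * (inner ℂ (toL2 u) (toL2 g)).re) fun c _ => ?_
  have hgc := (hg.smul c).isMatGenerator_rowFun
  refine (h _ (matDom_subset_dirichletAlgebra ⟨_, hgc⟩)).trans ?_
  rw [mul_left_comm, ← re_integral_trace_rowFun_smul u g c]
  gcongr
  exact ENNReal.toReal_le_of_le_ofReal hgc.re_integral_nonneg hgc.energy_le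

theorem logSobolevGen_nonpos (hu : ∫ ω, u ω ∂μ = 0) (hu0 : u ≠ 0) (hg : S.IsGenerator u g)
    {α : ℝ} (h : S.LogSobolevGen α) : α ≤ 0 :=
  nonpos_of_forall_mul_matEnt_rowFun_smul_le hu hu0 fun c _ =>
    (h _ _ (hg.smul c).isMatGenerator_rowFun).trans_eq (re_integral_trace_rowFun_smul u g c)

end SymmetricMarkovSemigroup

end RowFun

section DiagonalEntries

variable {n : Type*} [Fintype n] [DecidableEq n] {A : Matrix n n ℂ}

theorem inv_re_apply_le_re_inv_apply (hA : A.PosDef) (i : n) :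
    (A i i).re⁻¹ ≤ (A⁻¹ i i).re := by
  have hspec : spectrum ℝ A ⊆ Set.Ioi 0 := by
    rw [hA.isHermitian.spectrum_real_eq_range_eigenvalues]
    exact Set.range_subset_iff.2 hA.eigenvalues_pos
  have hconv : ConvexOn ℝ (Set.Ioi 0) fun x : ℝ => x⁻¹ := by
    simpa using convexOn_zpow (𝕜 := ℝ) (-1)
  have hinv : cfc (fun x : ℝ => x⁻¹) A = A⁻¹ := by
    have hherm : IsSelfAdjoint (hA.isUnit.unit : Matrix n n ℂ) := hA.isHermitian
    exact (cfc_inv_id (R := ℝ) hA.isUnit.unit).trans (Matrix.coe_units_inv _)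
  simpa [hinv] using
    map_re_conjTranspose_mul_mul_apply_le hA.isHermitian hconv hspec (U := (1 : Matrix n n ℂ))
      (by simp) i

theorem sum_rpow_re_apply_le_sum_rpow_eigenvalues (hA : A.PosSemidef) {R : ℝ} (hR : 1 ≤ R) :
    ∑ i, (A i i).re ^ R ≤ ∑ i, hA.isHermitian.eigenvalues i ^ R := by
  have h := sum_map_re_conjTranspose_mul_mul_apply_le_trace_cfc hA.isHermitian
    (convexOn_rpow hR) (posSemidef_iff_isHermitian_and_spectrum_real_subset.1 hA).2 (U := 1)
    (by simp)
  rw [re_trace_cfc hA.isHermitian] at h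
  simpa using h

end DiagonalEntries

section Schatten

variable {A : Matrix (Fin 2) (Fin 2) ℂ} {p : ℝ≥0∞}

theorem schattenNorm_two (A : Matrix (Fin 2) (Fin 2) ℂ) :
    schattenNorm 2 A = √(Aᴴ * A).trace.re := by
  have hA := Matrix.isHermitian_conjTranspose_mul_self A
  have hnn := (Matrix.posSemidef_conjTranspose_mul_self A).eigenvalues_nonneg
  rw [schattenNorm, EuclideanSpace.norm_eq, hA.trace_eq_sum_eigenvalues, Complex.re_sum]
  congr 1
  exact Finset.sum_congr rfl fun i _ => by simp [Real.sq_sqrt (hnn i)]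

theorem schattenNorm_top_one : schattenNorm ∞ 1 = 1 := by
  have hone (i : Fin 2) : (Matrix.isHermitian_conjTranspose_mul_self
      (1 : Matrix (Fin 2) (Fin 2) ℂ)).eigenvalues i = 1 := by
    have hspec : spectrum ℝ ((1 : Matrix (Fin 2) (Fin 2) ℂ)ᴴ * 1) = {1} := by
      rw [Matrix.conjTranspose_one, Matrix.mul_one, spectrum.one_eq]
    exact hspec.subset (Matrix.IsHermitian.eigenvalues_mem_spectrum_real _ i)
  rw [schattenNorm, PiLp.norm_eq_ciSup]
  simp only [hone, Real.sqrt_one, norm_one, ciSup_const]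

theorem sqrt_trace_le_schattenNorm (hp : 1 ≤ p) (hA : A.det = 0) :
    √(Aᴴ * A).trace.re ≤ schattenNorm p A := by
  have : Fact (1 ≤ p) := ⟨hp⟩
  have hH := Matrix.isHermitian_conjTranspose_mul_self A
  have hle (i : Fin 2) : √(hH.eigenvalues i) ≤ schattenNorm p A :=
    (le_abs_self _).trans (PiLp.norm_apply_le (WithLp.toLp p fun i => √(hH.eigenvalues i)) i)
  have htr : (Aᴴ * A).trace.re = hH.eigenvalues 0 + hH.eigenvalues 1 := by
    simp [hH.trace_eq_sum_eigenvalues, Fin.sum_univ_two]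
  have hdet : hH.eigenvalues 0 = 0 ∨ hH.eigenvalues 1 = 0 := by
    have h := hH.det_eq_prod_eigenvalues
    rw [Matrix.det_mul, hA, mul_zero, Fin.prod_univ_two] at h
    simpa using h.symm
  rw [htr]
  rcases hdet with h | h
  · rw [h, zero_add]
    exact hle 1
  · rw [h, add_zero]
    exact hle 0

theorem sum_rpow_eigenvalues_eq_schattenNorm_rpow (hp : 0 < p.toReal)
    (A : Matrix (Fin 2) (Fin 2) ℂ) :
    ∑ i, (Matrix.isHermitian_conjTranspose_mul_self A).eigenvalues i ^ (p.toReal / 2) =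
      schattenNorm p A ^ p.toReal := by
  have hnn := (Matrix.posSemidef_conjTranspose_mul_self A).eigenvalues_nonneg
  rw [schattenNorm, PiLp.norm_eq_sum hp, one_div, Real.rpow_inv_rpow _ hp.ne']
  · refine Finset.sum_congr rfl fun i _ => ?_
    rw [Real.norm_of_nonneg (Real.sqrt_nonneg _), Real.sqrt_eq_rpow, ← Real.rpow_mul (hnn i)]
    congr 1
    ring
  · positivity

theorem sum_rpow_re_apply_le_schattenNorm_rpow (hp : 2 ≤ p.toReal)
    (A : Matrix (Fin 2) (Fin 2) ℂ) :
    ∑ i, ((Aᴴ * A) i i).re ^ (p.toReal / 2) ≤ schattenNorm p A ^ p.toReal := by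
  rw [← sum_rpow_eigenvalues_eq_schattenNorm_rpow (by linarith)]
  exact sum_rpow_re_apply_le_sum_rpow_eigenvalues
    (Matrix.posSemidef_conjTranspose_mul_self A) (by linarith)

theorem two_le_toReal_pisierExponent {p : ℝ} (hp : 2 < p) : 2 ≤ (pisierExponent p).toReal := by
  have hlt : 1 / p < 1 / 2 := by gcongr
  have hpos : 0 < 1 / p := by positivity
  rw [pisierExponent, ENNReal.toReal_inv, ENNReal.toReal_ofReal (by linarith),
    le_inv_comm₀ (by norm_num) (by linarith)]
  linarith

theorem one_add_div_le_inv_of_rpow_add_rpow_le_one {R a b : ℝ} (hR : 1 ≤ R) (ha : 0 < a)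
    (h : a ^ R + b ^ R ≤ 1) : 1 + b ^ R / R ≤ a⁻¹ := by
  have hR0 : 0 < R := by linarith
  have hbern := one_add_mul_self_le_rpow_one_add (s := a - 1) (by linarith) hR
  rw [add_sub_cancel] at hbern
  have hdiv : b ^ R / R ≤ 1 - a := by
    rw [div_le_iff₀ hR0]
    linarith
  have hinv : 2 - a ≤ a⁻¹ := by
    rw [← one_div, le_div_iff₀ ha]
    nlinarith [sq_nonneg (1 - a)]
  linarith

theorem one_add_min_le_inv_add_mul_inv {R K a b s : ℝ} (hR : 1 ≤ R) (hK : 0 < K) (ha : 0 < a)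
    (hb : 0 < b) (hs : 0 ≤ s) (h : a ^ R + b ^ R ≤ 1) :
    1 + min (K * s) (K⁻¹ ^ R / R) ≤ a⁻¹ + s * b⁻¹ := by
  have : 0 < R := by linarith
  have hinv := one_add_div_le_inv_of_rpow_add_rpow_le_one hR ha h
  rcases le_total b K⁻¹ with hbK | hbK
  · have hK' : K ≤ b⁻¹ := (le_inv_comm₀ hb hK).1 hbK
    calc 1 + min (K * s) (K⁻¹ ^ R / R) ≤ 1 + s * K := by
          rw [mul_comm s]
          gcongr
          exact min_le_left _ _
      _ ≤ a⁻¹ + s * b⁻¹ := by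
          gcongr
          exact (le_add_of_nonneg_right (by positivity)).trans hinv
  · calc 1 + min (K * s) (K⁻¹ ^ R / R) ≤ 1 + b ^ R / R := by
          gcongr
          exact (min_le_right _ _).trans (by gcongr)
      _ ≤ a⁻¹ + s * b⁻¹ := hinv.trans (le_add_of_nonneg_right (by positivity))

theorem one_add_min_le_re_inv_conjTranspose_mul_self_apply (hp : 2 ≤ p.toReal)
    (hA : A.det ≠ 0) (hn : schattenNorm p A = 1) {K s : ℝ} (hK : 0 < K) (hs : 0 ≤ s) :
    1 + min (K * s) (K⁻¹ ^ (p.toReal / 2) / (p.toReal / 2)) ≤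
      ((Aᴴ * A)⁻¹ 0 0).re + s * ((Aᴴ * A)⁻¹ 1 1).re := by
  have hpos : (Aᴴ * A).PosDef := Matrix.PosDef.conjTranspose_mul_self A
    (Matrix.mulVec_injective_of_isUnit ((Matrix.isUnit_iff_isUnit_det A).2 hA.isUnit))
  have hdiag (i : Fin 2) : 0 < ((Aᴴ * A) i i).re := (Complex.lt_def.1 hpos.diag_pos).1
  have hsum := sum_rpow_re_apply_le_schattenNorm_rpow hp A
  rw [Fin.sum_univ_two, hn, Real.one_rpow] at hsum
  refine (one_add_min_le_inv_add_mul_inv (by linarith) hK (hdiag 0) (hdiag 1) hs hsum).trans ?_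
  gcongr
  · exact inv_re_apply_le_re_inv_apply hpos 0
  · exact inv_re_apply_le_re_inv_apply hpos 1

theorem one_le_re_inv_conjTranspose_mul_self_apply (hp : 2 ≤ p.toReal) (hA : A.det ≠ 0)
    (hn : schattenNorm p A = 1) : 1 ≤ ((Aᴴ * A)⁻¹ 0 0).re := by
  have h := one_add_min_le_re_inv_conjTranspose_mul_self_apply hp hA hn one_pos le_rfl
  rwa [mul_zero, min_eq_left (by positivity), add_zero, zero_mul, add_zero] at h

end Schatten

section VectorValuedNorms

variable {Ω : Type*} [MeasurableSpace Ω] {μ : Measure Ω} {F : Ω → Matrix (Fin 2) (Fin 2) ℂ}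

theorem eLpNorm_sqrt_two {g : Ω → ℝ} (hg : Integrable g μ) (hnn : ∀ ω, 0 ≤ g ω) :
    eLpNorm (fun ω => √(g ω)) 2 μ = ENNReal.ofReal √(∫ ω, g ω ∂μ) := by
  have hsq : ∀ ω, √(g ω) ^ 2 = g ω := fun ω => Real.sq_sqrt (hnn ω)
  have hmem : MemLp (fun ω => √(g ω)) 2 μ :=
    (memLp_two_iff_integrable_sq (Real.continuous_sqrt.comp_aestronglyMeasurable hg.1)).2
      (by simpa only [hsq] using hg)
  rw [hmem.eLpNorm_eq_integral_rpow_norm two_ne_zero ENNReal.ofNat_ne_top, Real.sqrt_eq_rpow]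
  simp [hsq]

open scoped Matrix.Norms.L2Operator

theorem integrable_trace_conjTranspose_mul_self [IsFiniteMeasure μ] (hF : MemLp F ∞ μ) :
    Integrable (fun ω => ((F ω)ᴴ * F ω).trace.re) μ :=
  integrable_comp_of_memLp_top (ψ := fun A : Matrix (Fin 2) (Fin 2) ℂ => (Aᴴ * A).trace.re)
    (by fun_prop) hF

theorem matLpNorm_two [IsFiniteMeasure μ] (hF : MemLp F ∞ μ) :
    matLpNorm μ 2 F = ENNReal.ofReal √(normSqL2 μ F) := by
  simp only [matLpNorm, schattenNorm_two]
  exact eLpNorm_sqrt_two (integrable_trace_conjTranspose_mul_self hF)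
    fun ω => re_trace_conjTranspose_mul_self_nonneg _

theorem sqrt_normSqL2_le_matLpNorm [IsProbabilityMeasure μ] (hF : MemLp F ∞ μ)
    (hdet : ∀ ω, (F ω).det = 0) {p : ℝ≥0∞} (hp : 2 ≤ p) :
    ENNReal.ofReal √(normSqL2 μ F) ≤ matLpNorm μ p F := by
  have hint := integrable_trace_conjTranspose_mul_self hF
  calc ENNReal.ofReal √(normSqL2 μ F) = eLpNorm (fun ω => √((F ω)ᴴ * F ω).trace.re) 2 μ :=
        (eLpNorm_sqrt_two hint fun ω => re_trace_conjTranspose_mul_self_nonneg _).symm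
    _ ≤ eLpNorm (fun ω => √((F ω)ᴴ * F ω).trace.re) p μ :=
        eLpNorm_le_eLpNorm_of_exponent_le hp
          (Real.continuous_sqrt.comp_aestronglyMeasurable hint.1)
    _ ≤ matLpNorm μ p F := by
        refine eLpNorm_mono fun ω => ?_
        rw [Real.norm_of_nonneg (Real.sqrt_nonneg _)]
        exact (sqrt_trace_le_schattenNorm (one_le_two.trans hp) (hdet ω)).trans (le_abs_self _)

theorem trace_conjTranspose_mul_self_mul_row_mul (X Y : Matrix (Fin 2) (Fin 2) ℂ) (z : ℂ) :
    ((X * !![1, z; 0, 0] * Y)ᴴ * (X * !![1, z; 0, 0] * Y)).trace.re =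
      ((Xᴴ * X) 0 0).re * (((Y * Yᴴ) 0 0).re + 2 * (z * (Y * Yᴴ) 1 0).re +
        ‖z‖ ^ 2 * ((Y * Yᴴ) 1 1).re) := by
  simp only [Complex.sq_norm, Complex.normSq_apply]
  simp only [Matrix.conjTranspose_mul, Matrix.trace_fin_two, Matrix.mul_apply,
    Matrix.conjTranspose_apply, RCLike.star_def, Matrix.of_apply, Matrix.cons_val',
    Matrix.cons_val_fin_one, Fin.sum_univ_two, Matrix.cons_val_zero, Matrix.cons_val_one, map_one,
    one_mul, map_zero, zero_mul, add_zero, mul_one, mul_zero, Complex.add_re, Complex.mul_re,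
    Complex.conj_re, Complex.conj_im, Complex.mul_im, Complex.add_im]
  ring

theorem pisierNorm_two_le_matLpNorm (F : Ω → Matrix (Fin 2) (Fin 2) ℂ) :
    pisierNorm μ 2 F ≤ matLpNorm μ 2 F := by
  have hone : schattenNorm (pisierExponent 2) 1 = 1 := by
    have htop : pisierExponent 2 = ∞ := by simp [pisierExponent]
    rw [htop, schattenNorm_top_one]
  refine (iInf₂_le 1 1).trans
    ((iInf₂_le ⟨Matrix.PosDef.one, hone⟩ ⟨Matrix.PosDef.one, hone⟩).trans ?_)
  simp

theorem ofReal_normSqL2 (F : Ω → Matrix (Fin 2) (Fin 2) ℂ) :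
    (normSqL2 μ F : ℂ) = ∫ ω, ((F ω)ᴴ * F ω).trace ∂μ := by
  rw [normSqL2, ← integral_complex_ofReal]
  congr 1 with ω
  exact (Complex.eq_re_of_ofReal_le
    (Matrix.posSemidef_conjTranspose_mul_self (F ω)).trace_nonneg).symm

theorem normSqL2_toFun [IsFiniteMeasure μ] (f : MatLinf μ) :
    normSqL2 μ f.toFun = ∑ j, ∑ i, ‖toL2 (f i j)‖ ^ 2 := by
  refine Complex.ofReal_injective ?_
  rw [ofReal_normSqL2, integral_trace_conjTranspose_mul]
  push_cast
  simp only [inner_self_eq_norm_sq_to_K]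
  rfl

variable [IsProbabilityMeasure μ] {v : Lp ℂ ∞ μ}

theorem normSqL2_mul_rowFun_mul (hv : ∫ ω, v ω ∂μ = 0) (X Y : Matrix (Fin 2) (Fin 2) ℂ) :
    normSqL2 μ (fun ω => X * (rowFun v).toFun ω * Y) =
      ((Xᴴ * X) 0 0).re * (((Y * Yᴴ) 0 0).re + ‖toL2 v‖ ^ 2 * ((Y * Yᴴ) 1 1).re) := by
  have hint : Integrable (fun ω => v ω * (Y * Yᴴ) 1 0) μ :=
    ((Lp.memLp v).integrable le_top).mul_const _
  have hcross : ∫ ω, (v ω * (Y * Yᴴ) 1 0).re ∂μ = 0 := by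
    have h := integral_re hint
    rw [integral_mul_const, hv, zero_mul, _root_.map_zero] at h
    exact h
  simp only [normSqL2, toFun_rowFun, trace_conjTranspose_mul_self_mul_row_mul]
  have hre : Integrable (fun ω => 2 * (v ω * (Y * Yᴴ) 1 0).re) μ := hint.re.const_mul 2
  have hlin : Integrable (fun ω => ((Y * Yᴴ) 0 0).re + 2 * (v ω * (Y * Yᴴ) 1 0).re) μ :=
    (integrable_const _).add hre
  rw [integral_const_mul, integral_add hlin ((integrable_norm_sq v).mul_const _),
    integral_add (integrable_const _) hre, integral_const_mul, integral_mul_const,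
    norm_toL2_sq, hcross]
  simp

theorem normSqL2_rowFun (hv : ∫ ω, v ω ∂μ = 0) :
    normSqL2 μ (rowFun v).toFun = 1 + ‖toL2 v‖ ^ 2 := by
  simpa using normSqL2_mul_rowFun_mul hv 1 1

theorem sqrt_one_add_min_le_pisierNorm_rowFun {p K : ℝ} (hp : 2 < p) (hK : 0 < K)
    (hv : ∫ ω, v ω ∂μ = 0) :
    ENNReal.ofReal √(1 + min (K * ‖toL2 v‖ ^ 2)
      (K⁻¹ ^ ((pisierExponent p).toReal / 2) / ((pisierExponent p).toReal / 2))) ≤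
      pisierNorm μ p (rowFun v).toFun := by
  have hq := two_le_toReal_pisierExponent hp
  refine le_iInf fun x => le_iInf fun y => le_iInf fun ⟨hx, hxn⟩ => le_iInf fun ⟨hy, hyn⟩ => ?_
  have hxx : (x⁻¹)ᴴ * x⁻¹ = (xᴴ * x)⁻¹ := by
    rw [Matrix.conjTranspose_nonsing_inv, hx.isHermitian.eq, Matrix.mul_inv_rev]
  have hyy : y⁻¹ * (y⁻¹)ᴴ = (yᴴ * y)⁻¹ := by
    rw [Matrix.conjTranspose_nonsing_inv, hy.isHermitian.eq, Matrix.mul_inv_rev]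
  have hmem : MemLp (fun ω => x⁻¹ * (rowFun v).toFun ω * y⁻¹) ∞ μ :=
    MemLp.mul_const ((memLp_toFun (rowFun v)).const_mul x⁻¹) y⁻¹
  have hdet (ω : Ω) : (x⁻¹ * (rowFun v).toFun ω * y⁻¹).det = 0 := by
    simp [toFun_rowFun, Matrix.det_mul]
  refine le_trans ?_ (sqrt_normSqL2_le_matLpNorm hmem hdet ?_)
  · rw [normSqL2_mul_rowFun_mul hv, hxx, hyy]
    gcongr
    have hgap := one_add_min_le_re_inv_conjTranspose_mul_self_apply hq hy.det_pos.ne' hyn hK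
      (sq_nonneg ‖toL2 v‖)
    refine hgap.trans (le_mul_of_one_le_left ?_
      (one_le_re_inv_conjTranspose_mul_self_apply hq hx.det_pos.ne' hxn))
    exact (by positivity : (0 : ℝ) ≤ 1 + min _ _).trans hgap
  · rw [← ENNReal.ofReal_ofNat]
    exact ENNReal.ofReal_le_ofReal hp.le

namespace SymmetricMarkovSemigroup

variable (S : SymmetricMarkovSemigroup μ)

theorem hypercontractive_zero (C : Set (MatLinf μ)) : S.Hypercontractive C 0 := by
  refine ⟨le_rfl, fun f _ t => ?_⟩
  have htwo : 1 + Real.exp (2 * 0 * t) = 2 := by norm_num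
  rw [htwo]
  refine (pisierNorm_two_le_matLpNorm _).trans ?_
  rw [matLpNorm_two (memLp_toFun _), matLpNorm_two (memLp_toFun _), normSqL2_toFun,
    normSqL2_toFun]
  gcongr with j _ i
  exact S.norm_toL2_T_le t (f i j)

variable {S}

theorem hypercontractive_nonpos {C : Set (MatLinf μ)} {u : Lp ℂ ∞ μ} (hu : ∫ ω, u ω ∂μ = 0)
    (hu0 : u ≠ 0) (hC : ∀ c : ℂ, rowFun (c • u) ∈ C) {α : ℝ} (h : S.Hypercontractive C α) :
    α ≤ 0 := by
  by_contra! hα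
  have hu2 : toL2 u ≠ 0 := toL2_ne_zero_iff.2 hu0
  have hTu2 : toL2 (S.T 1 u) ≠ 0 :=
    toL2_ne_zero_iff.2 ((map_ne_zero_iff _ (S.T_injective 1)).2 hu0)
  set p : ℝ := 1 + Real.exp (2 * α * (1 : ℝ≥0))
  have hp : 2 < p := by
    have : 1 < Real.exp (2 * α * (1 : ℝ≥0)) := Real.one_lt_exp_iff.2 (by positivity)
    linarith
  set K : ℝ := 2 * ‖toL2 u‖ ^ 2 / ‖toL2 (S.T 1 u)‖ ^ 2 with hK_def
  have hK : 0 < K := by positivity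
  set η : ℝ := K⁻¹ ^ ((pisierExponent p).toReal / 2) / ((pisierExponent p).toReal / 2)
  have hη : 0 < η := by
    have := two_le_toReal_pisierExponent hp
    positivity
  obtain ⟨c, -, hc⟩ := exists_norm_toL2_smul_sq_eq hu0 (half_pos hη)
  have hKη : K * ‖toL2 (S.T 1 (c • u))‖ ^ 2 = η := by
    rw [norm_toL2_smul_sq] at hc
    rw [map_smul, norm_toL2_smul_sq, hK_def]
    field_simp
    linarith
  have hT0 : ∫ ω, S.T 1 (c • u) ω ∂μ = 0 := (S.integral_T _ _).trans (integral_smul_eq_zero hu c)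
  have hle := (sqrt_one_add_min_le_pisierNorm_rowFun hp hK hT0).trans
    ((S.amp_rowFun 1 (c • u)) ▸ h.2 _ (hC c) 1)
  rw [matLpNorm_two (memLp_toFun _), normSqL2_rowFun (integral_smul_eq_zero hu c), hc, hKη,
    min_self, ENNReal.ofReal_le_ofReal_iff (Real.sqrt_nonneg _),
    Real.sqrt_le_sqrt_iff (by positivity)] at hle
  linarith

end SymmetricMarkovSemigroup

end VectorValuedNorms

end MatrixLSI
end

open MatrixLSI MatrixLSI.SymmetricMarkovSemigroup in
theorem mainTheorem7_general {Ω : Type*} [MeasurableSpace Ω] (μ : MeasureTheory.Measure Ω)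
    [MeasureTheory.IsProbabilityMeasure μ]
    (hμ : ∃ X : Set Ω, MeasurableSet X ∧ 0 < μ X ∧ μ X < 1)
    (S : MatrixLSI.SymmetricMarkovSemigroup μ) :
    (IsGreatest {α : ℝ | S.Rothaus S.dirichletAlgebra α} 0 ∧
      IsGreatest {α : ℝ | S.LogSobolevForm α} 0 ∧
      IsGreatest {α : ℝ | S.Hypercontractive S.dirichletAlgebra α} 0) ∧
    (IsGreatest {α : ℝ | S.Rothaus S.matDom α} 0 ∧
      IsGreatest {α : ℝ | S.LogSobolevGen α} 0 ∧
      IsGreatest {α : ℝ | S.Hypercontractive S.matDom α} 0) := by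
  obtain ⟨u, g, hg, hu, hu0⟩ := S.exists_isGenerator_integral_eq_zero hμ
  have hdom (c : ℂ) : rowFun (c • u) ∈ S.matDom := (hg.smul c).rowFun_mem_matDom
  have hform (c : ℂ) : rowFun (c • u) ∈ S.dirichletAlgebra :=
    matDom_subset_dirichletAlgebra (hdom c)
  exact ⟨⟨⟨S.rothaus_zero _, fun _ => rothaus_nonpos (S := S) hu hu0 hform⟩,
      ⟨S.logSobolevForm_zero, fun _ => logSobolevForm_nonpos hu hu0 hg⟩,
      ⟨S.hypercontractive_zero _, fun _ => hypercontractive_nonpos hu hu0 hform⟩⟩,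
    ⟨⟨S.rothaus_zero _, fun _ => rothaus_nonpos (S := S) hu hu0 hdom⟩,
      ⟨S.logSobolevGen_zero, fun _ => logSobolevGen_nonpos hu hu0 hg⟩,
      ⟨S.hypercontractive_zero _, fun _ => hypercontractive_nonpos hu hu0 hdom⟩⟩⟩

theorem mainTheorem7 {Ω : Type*} [MeasurableSpace Ω] (μ : MeasureTheory.Measure Ω)
    [MeasureTheory.IsProbabilityMeasure μ]
    (hμ : ∃ X : Set Ω, MeasurableSet X ∧ 0 < μ X ∧ μ X < 1)
    (S : MatrixLSI.SymmetricMarkovSemigroup μ) (hS : S.IsErgodic) :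
    (IsGreatest {α : ℝ | S.Rothaus S.dirichletAlgebra α} 0 ∧
      IsGreatest {α : ℝ | S.LogSobolevForm α} 0 ∧
      IsGreatest {α : ℝ | S.Hypercontractive S.dirichletAlgebra α} 0) ∧
    (IsGreatest {α : ℝ | S.Rothaus S.matDom α} 0 ∧
      IsGreatest {α : ℝ | S.LogSobolevGen α} 0 ∧
      IsGreatest {α : ℝ | S.Hypercontractive S.matDom α} 0) :=
  mainTheorem7_general μ hμ S
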